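/- Let $\Omega$ be a finite set of states and let $I,J$ be finite nonempty sets of actions, let $g:\Omega\times I\times J\to[0,1]$ be a payoff function and $q:\Omega\times I\times J\to\Delta(\Omega)$ a transition, where $\Delta(X)$ is the set of probability distributions over a finite set $X$. For $\lambda\in(0,1]$ and $\omega\in\Omega$ let $\Gamma_\lambda(\omega)$ be the zero-sum game starting at $\omega_1=\omega$ in which at every stage $m\ge1$ the players, knowing the current state $\omega_m$ and the past play, choose actions $(i_m,j_m)\in I\times J$ simultaneously and independently, possibly at random, the next state $\omega_{m+1}$ is drawn from $q(\cdot\mid\omega_m,i_m,j_m)$, and player $1$ receives $\sum_{m\ge1}\lambda(1-\lambda)^{m-1}g(\omega_m,i_m,j_m)$ from player $2$. Let $\gamma_\lambda(\omega,\sigma,\tau)$ be the expected payoff in $\Gamma_\lambda(\omega)$ when the players use the (behaviour) strategies $\sigma,\tau$. The game $\Gamma_\lambda(\omega)$ has a value $v_\lambda(\omega)=\sup_\sigma\inf_\tau\gamma_\lambda(\omega,\sigma,\tau)=\inf_\tau\sup_\sigma\gamma_\lambda(\omega,\sigma,\tau)$ for all $\lambda\in(0,1]$ and $\omega\in\Omega$,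 and the limit $\lim_{\lambda\to0}v_\lambda$ exists in $\mathbb R^\Omega$. Moreover, there are $\mathbf c(\omega,i)>0$ and $\mathbf e(\omega,i)\ge0$, for $(\omega,i)\in\Omega\times I$, with $\sum_{i\in I:\ \mathbf e(\omega,i)=0}\mathbf c(\omega,i)=1$ for all $\omega\in\Omega$, such that the family of stationary strategies $$\mathbf x_\lambda^i(\omega)=\frac{\mathbf c(\omega,i)\lambda^{\mathbf e(\omega,i)}}{\sum_{i'\in I}\mathbf c(\omega,i')\lambda^{\mathbf e(\omega,i')}},\qquad \lambda\in(0,1],$$ is asymptotically optimal for player $1$: for all $\varepsilon>0$ there exists $\lambda_0\in(0,1]$ such that $$\gamma_\lambda(\omega,\mathbf x_\lambda,y)\ \ge\ \lim_{\lambda'\to0}v_{\lambda'}(\omega)-\varepsilon\qquad\text{for all }\omega\in\Omega,\ \text{all } y\in\Delta(J)^\Omega\text{ and all }\lambda\in(0,\lambda_0),$$ where $y$ is regarded as the stationary strategy of player $2$ that plays $y(\omega)$ whenever the current state is $\omega$. -/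

import Mathlib

open Filter Topology

/-- A finite two-person zero-sum stochastic game with state set `Ω` and action sets `I` and `J`:
a stage payoff `g` with values in `[0,1]` and a transition `q` with values in the probability
distributions over `Ω`. -/
structure StochasticGame (Ω I J : Type*) [Fintype Ω] where
  g : Ω → I → J → ℝ
  g_nonneg : ∀ ω i j, 0 ≤ g ω i j
  g_le_one : ∀ ω i j, g ω i j ≤ 1
  q : Ω → I → J → stdSimplex ℝ Ω

/-- Past play: the triples (state, action of player 1, action of player 2) of the past stages,
the most recent one first. -/
abbrev PastPlay (Ω I J : Type*) : Type _ := List (Ω × I × J)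

/-- Behaviour strategies of player 1: a mixed action for every past play and current state. -/
abbrev StrategyOne (Ω I J : Type*) [Fintype I] : Type _ := PastPlay Ω I J → Ω → stdSimplex ℝ I

/-- Behaviour strategies of player 2. -/
abbrev StrategyTwo (Ω I J : Type*) [Fintype J] : Type _ := PastPlay Ω I J → Ω → stdSimplex ℝ J

/-- The stationary strategy of player 1 playing `x ω` whenever the current state is `ω`. -/
def stationaryOne {Ω I J : Type*} [Fintype I] (x : Ω → stdSimplex ℝ I) : StrategyOne Ω I J :=
  fun _ ω => x ω

/-- The stationary strategy of player 2 playing `y ω` whenever the current state is `ω`. -/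
def stationaryTwo {Ω I J : Type*} [Fintype J] (y : Ω → stdSimplex ℝ J) : StrategyTwo Ω I J :=
  fun _ ω => y ω

namespace StochasticGame

variable {Ω I J : Type*} [Fintype Ω] [Fintype I] [Fintype J]

/-- `G.stagePayoff σ τ n h ω` is the conditional expectation, given that the past play is `h` and
the current state is `ω`, of the stage payoff `n` stages from now, when the players use `σ` and
`τ`. The two players randomize independently. -/
def stagePayoff (G : StochasticGame Ω I J) (σ : StrategyOne Ω I J) (τ : StrategyTwo Ω I J) :
    ℕ → PastPlay Ω I J → Ω → ℝ
  | 0, h, ω => ∑ i, ∑ j, σ h ω i * τ h ω j * G.g ω i j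
  | n + 1, h, ω => ∑ i, ∑ j, σ h ω i * τ h ω j *
      ∑ ω', G.q ω i j ω' * G.stagePayoff σ τ n ((ω, i, j) :: h) ω'

/-- The expected payoff `∑_{m ≥ 1} lam (1 - lam)^(m-1) E[g(ω_m, i_m, j_m)]` in the game with
initial state `ω` and discount factor `lam ∈ (0,1]` (a convergent series, since `0 ≤ g ≤ 1`). -/
noncomputable def payoff (G : StochasticGame Ω I J) (lam : ℝ) (ω : Ω)
    (σ : StrategyOne Ω I J) (τ : StrategyTwo Ω I J) : ℝ :=
  ∑' n : ℕ, lam * (1 - lam) ^ n * G.stagePayoff σ τ n [] ω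

/-- The lower value (maxmin) of the discounted game starting at `ω`. -/
noncomputable def lowerValue (G : StochasticGame Ω I J) (lam : ℝ) (ω : Ω) : ℝ :=
  ⨆ σ : StrategyOne Ω I J, ⨅ τ : StrategyTwo Ω I J, G.payoff lam ω σ τ

/-- The upper value (minmax) of the discounted game starting at `ω`. -/
noncomputable def upperValue (G : StochasticGame Ω I J) (lam : ℝ) (ω : Ω) : ℝ :=
  ⨅ τ : StrategyTwo Ω I J, ⨆ σ : StrategyOne Ω I J, G.payoff lam ω σ τ

/-- `w` is the value of the game with initial state `ω` and discount factor `lam`. -/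
def IsValue (G : StochasticGame Ω I J) (lam : ℝ) (ω : Ω) (w : ℝ) : Prop :=
  G.lowerValue lam ω = w ∧ G.upperValue lam ω = w

end StochasticGame

/-- Coefficients `c > 0` and exponents `e ≥ 0` such that, in every state, the coefficients of the
actions with exponent `0` sum up to `1`. -/
structure CanonicalData (Ω I : Type*) [Fintype I] where
  c : Ω → I → ℝ
  e : Ω → I → ℝ
  c_pos : ∀ ω i, 0 < c ω i
  e_nonneg : ∀ ω i, 0 ≤ e ω i
  sum_c : ∀ ω, ∑ i with e ω i = 0, c ω i = 1

/-- The canonical family of stationary strategies induced by `(c, e)`: at `ω`, the action `i` has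
probability `c ω i * lam ^ e ω i / ∑ i', c ω i' * lam ^ e ω i'`. -/
noncomputable def CanonicalData.strategy {Ω I : Type*} [Fintype I] [Nonempty I]
    (x : CanonicalData Ω I) (lam : ℝ) (hlam : 0 < lam) (ω : Ω) : stdSimplex ℝ I :=
  ⟨fun i => x.c ω i * lam ^ x.e ω i / ∑ i', x.c ω i' * lam ^ x.e ω i', by
    have hpos : ∀ i, 0 < x.c ω i * lam ^ x.e ω i := fun i =>
      mul_pos (x.c_pos ω i) (Real.rpow_pos_of_pos hlam _)
    have hsum : 0 < ∑ i', x.c ω i' * lam ^ x.e ω i' :=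
      Finset.sum_pos (fun i _ => hpos i) Finset.univ_nonempty
    refine ⟨fun i => (div_pos (hpos i) hsum).le, ?_⟩
    rw [← Finset.sum_div, div_self hsum.ne']⟩

/-!
The values of the discounted game are handled by Shapley's theorem
(`StochasticGame.exists_value_of_discounted`): the minimax theorem makes the one-shot operator a
contraction, and optimal actions in the one-shot games at its fixed point are optimal stationary
strategies. Mixing with the uniform distribution, player 1 also has a *fully supported* stationary
strategy that is optimal up to `lam`.

The convergence of the values and the canonical family come out of one comparison. Let `U` be an
ultrafilter of discount factors tending to `0`, and let `X lam` be fully supported and optimal up to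
`lam`. Then there is a canonical family that has, as `lam → 0`, the same limit payoffs against every
pure stationary strategy as `X` has along `U`
(`StochasticGame.exists_canonicalData_of_ultrafilter`). As player 2 has pure stationary best replies
to stationary strategies (`StochasticGame.exists_pure_bestReply`), the canonical family guarantees,
up to `ε` and for *all* small `lam`, the limit of the values along `U`. So the limits along any two
ultrafilters bound each other, the values converge, and every canonical family obtained in this way
is asymptotically optimal.

The comparison rests on two facts.

* The payoff of `X lam` against a pure stationary strategy is a quotient of polynomials with
  nonnegative coefficients in `lam / (1 - lam)` and in the probabilities `X lam ω i`. This is seen by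
  eliminating the states of the induced Markov chain one by one, writing `1` minus the probability of
  staying as the sum of the probabilities of leaving, so that no subtraction occurs
  (`exists_subtractionFree_solution`). Hence the limit of the payoff is determined by the limits of
  the ratios of finitely many monomials (`SubtractionFree.exists_transfer`).
* The limits of finitely many ratios of monomials can be reproduced by a curve with coordinates
  `c s * lam ^ e s` (`exists_exponents`). In logarithms, the exponents `e` are a linear form that
  vanishes on the vectors with a finite limit and is positive on the finitely many relevant vectors
  with limit `-∞`: it exists by the Hahn-Banach theorem. The coefficients `c` extend the limit, which
  is linear on the vectors where it is finite.
-/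

/-! ### Matrix games -/

section MatrixGames

variable {I J : Type*} [Fintype I] [Fintype J]

/-- The expected payoff of the mixed actions `x` and `y` in the matrix game `M`. -/
def mixedPayoff (M : I → J → ℝ) (x : stdSimplex ℝ I) (y : stdSimplex ℝ J) : ℝ :=
  ∑ i, ∑ j, x i * y j * M i j

theorem mixedPayoff_mono {M N : I → J → ℝ} (h : ∀ i j, M i j ≤ N i j)
    (x : stdSimplex ℝ I) (y : stdSimplex ℝ J) : mixedPayoff M x y ≤ mixedPayoff N x y :=
  Finset.sum_le_sum fun i _ => Finset.sum_le_sum fun j _ =>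
    mul_le_mul_of_nonneg_left (h i j) (mul_nonneg (x.2.1 i) (y.2.1 j))

theorem mixedPayoff_const (c : ℝ) (x : stdSimplex ℝ I) (y : stdSimplex ℝ J) :
    mixedPayoff (fun _ _ => c) x y = c := by
  simp only [mixedPayoff, ← Finset.sum_mul, ← Finset.mul_sum]
  have h1 : ∑ i, x i = 1 := x.2.2
  have h2 : ∑ j, y j = 1 := y.2.2
  simp [h1, h2]

theorem le_mixedPayoff {M : I → J → ℝ} {c : ℝ} (h : ∀ i j, c ≤ M i j)
    (x : stdSimplex ℝ I) (y : stdSimplex ℝ J) : c ≤ mixedPayoff M x y :=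
  (mixedPayoff_const c x y).symm.le.trans (mixedPayoff_mono h x y)

theorem mixedPayoff_le {M : I → J → ℝ} {c : ℝ} (h : ∀ i j, M i j ≤ c)
    (x : stdSimplex ℝ I) (y : stdSimplex ℝ J) : mixedPayoff M x y ≤ c :=
  (mixedPayoff_mono h x y).trans (mixedPayoff_const c x y).le

theorem mixedPayoff_add (M N : I → J → ℝ) (x : stdSimplex ℝ I) (y : stdSimplex ℝ J) :
    mixedPayoff (fun i j => M i j + N i j) x y = mixedPayoff M x y + mixedPayoff N x y := by
  simp only [mixedPayoff, mul_add, Finset.sum_add_distrib]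

theorem mixedPayoff_mul_left (c : ℝ) (M : I → J → ℝ) (x : stdSimplex ℝ I) (y : stdSimplex ℝ J) :
    mixedPayoff (fun i j => c * M i j) x y = c * mixedPayoff M x y := by
  simp only [mixedPayoff, Finset.mul_sum]
  exact Finset.sum_congr rfl fun i _ => Finset.sum_congr rfl fun j _ => by ring

/-- Von Neumann's minimax theorem: a matrix game has a value and optimal mixed actions. -/
theorem exists_optimal_mixed [Nonempty I] [Nonempty J] (M : I → J → ℝ) :
    ∃ (v : ℝ) (x : stdSimplex ℝ I) (y : stdSimplex ℝ J),
      (∀ y', v ≤ mixedPayoff M x y') ∧ ∀ x', mixedPayoff M x' y ≤ v := by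
  classical
  let f : (J → ℝ) → (I → ℝ) → ℝ := fun y x => ∑ i, ∑ j, x i * y j * M i j
  have hlin1 : ∀ x : I → ℝ, IsLinearMap ℝ fun y => f y x := fun x =>
    ⟨fun a b => by simp only [f, Pi.add_apply, mul_add, add_mul, Finset.sum_add_distrib],
      fun c a => by
        simp only [f, Pi.smul_apply, smul_eq_mul, Finset.mul_sum]
        exact Finset.sum_congr rfl fun i _ => Finset.sum_congr rfl fun j _ => by ring⟩
  have hlin2 : ∀ y : J → ℝ, IsLinearMap ℝ fun x => f y x := fun y =>
    ⟨fun a b => by simp only [f, Pi.add_apply, add_mul, Finset.sum_add_distrib],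
      fun c a => by
        simp only [f, Pi.smul_apply, smul_eq_mul, Finset.mul_sum]
        exact Finset.sum_congr rfl fun i _ => Finset.sum_congr rfl fun j _ => by ring⟩
  have hc1 : ∀ x : I → ℝ, Continuous fun y => f y x := fun x => by
    simp only [f]; fun_prop
  have hc2 : ∀ y : J → ℝ, Continuous fun x => f y x := fun y => by
    simp only [f]; fun_prop
  have ne1 : (stdSimplex ℝ J).Nonempty :=
    ⟨_, single_mem_stdSimplex ℝ (Classical.arbitrary J)⟩
  have ne2 : (stdSimplex ℝ I).Nonempty :=
    ⟨_, single_mem_stdSimplex ℝ (Classical.arbitrary I)⟩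
  obtain ⟨b, hb, a, ha, hab⟩ := Sion.exists_isSaddlePointOn (f := f) ne1
    (convex_stdSimplex ℝ J) (isCompact_stdSimplex ℝ J)
    (fun x _ => (hc1 x).lowerSemicontinuous.lowerSemicontinuousOn _)
    (fun x _ => ((hlin1 x).mk' _ |>.convexOn (convex_stdSimplex ℝ J)).quasiconvexOn)
    (convex_stdSimplex ℝ I) ne2 (isCompact_stdSimplex ℝ I)
    (fun y _ => (hc2 y).upperSemicontinuous.upperSemicontinuousOn _)
    (fun y _ => ((hlin2 y).mk' _ |>.concaveOn (convex_stdSimplex ℝ I)).quasiconcaveOn)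
  exact ⟨f b a, ⟨a, ha⟩, ⟨b, hb⟩, fun y' => hab y' y'.2 a ha, fun x' => hab b hb x' x'.2⟩

end MatrixGames

/-! ### Discounted payoffs -/

namespace StochasticGame

section OneShot

variable {Ω I J : Type*} [Fintype Ω]

/-- The auxiliary matrix game of Shapley: the stage payoff, plus the continuation payoff `w` at
the next state. -/
def oneShot (G : StochasticGame Ω I J) (lam : ℝ) (w : Ω → ℝ) (ω : Ω) (i : I) (j : J) : ℝ :=
  lam * G.g ω i j + (1 - lam) * ∑ ω', G.q ω i j ω' * w ω'

theorem sum_q_mul_const (G : StochasticGame Ω I J) (ω : Ω) (i : I) (j : J) (c : ℝ) :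
    ∑ ω', G.q ω i j ω' * c = c := by
  have h : ∑ ω', G.q ω i j ω' = 1 := (G.q ω i j).2.2
  rw [← Finset.sum_mul, h, one_mul]

theorem oneShot_add_const (G : StochasticGame Ω I J) (lam : ℝ) (w : Ω → ℝ) (c : ℝ) (ω : Ω)
    (i : I) (j : J) :
    G.oneShot lam (fun ω' => w ω' + c) ω i j = G.oneShot lam w ω i j + (1 - lam) * c := by
  simp only [oneShot, mul_add, Finset.sum_add_distrib, sum_q_mul_const]
  ring

theorem oneShot_mono (G : StochasticGame Ω I J) {lam : ℝ} (hlam : lam ≤ 1) {w w' : Ω → ℝ}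
    (h : ∀ ω, w ω ≤ w' ω) (ω : Ω) (i : I) (j : J) :
    G.oneShot lam w ω i j ≤ G.oneShot lam w' ω i j := by
  refine add_le_add_right (mul_le_mul_of_nonneg_left (Finset.sum_le_sum fun ω' _ => ?_)
    (sub_nonneg.2 hlam)) _
  exact mul_le_mul_of_nonneg_left (h ω') ((G.q ω i j).2.1 ω')

end OneShot

variable {Ω I J : Type*} [Fintype Ω] [Fintype I] [Fintype J]

theorem stagePayoff_mem (G : StochasticGame Ω I J) (σ : StrategyOne Ω I J)
    (τ : StrategyTwo Ω I J) (n : ℕ) (h : PastPlay Ω I J) (ω : Ω) :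
    0 ≤ G.stagePayoff σ τ n h ω ∧ G.stagePayoff σ τ n h ω ≤ 1 := by
  induction n generalizing h ω with
  | zero =>
    change 0 ≤ mixedPayoff (G.g ω) (σ h ω) (τ h ω) ∧ mixedPayoff (G.g ω) (σ h ω) (τ h ω) ≤ 1
    exact ⟨le_mixedPayoff (G.g_nonneg ω) _ _, mixedPayoff_le (G.g_le_one ω) _ _⟩
  | succ n ih =>
    change 0 ≤ mixedPayoff (fun i j => ∑ ω', G.q ω i j ω' *
        G.stagePayoff σ τ n ((ω, i, j) :: h) ω') (σ h ω) (τ h ω) ∧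
      mixedPayoff (fun i j => ∑ ω', G.q ω i j ω' *
        G.stagePayoff σ τ n ((ω, i, j) :: h) ω') (σ h ω) (τ h ω) ≤ 1
    constructor
    · exact le_mixedPayoff (fun i j => Finset.sum_nonneg fun ω' _ =>
        mul_nonneg ((G.q ω i j).2.1 ω') (ih _ _).1) _ _
    · refine mixedPayoff_le (fun i j => ?_) _ _
      rw [← G.sum_q_mul_const ω i j 1]
      exact Finset.sum_le_sum fun ω' _ =>
        mul_le_mul_of_nonneg_left (ih _ _).2 ((G.q ω i j).2.1 ω')

/-- The discounted payoff of the first `N` stages after the past play `h`. -/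
def partialPayoff (G : StochasticGame Ω I J) (lam : ℝ) (σ : StrategyOne Ω I J)
    (τ : StrategyTwo Ω I J) (N : ℕ) (h : PastPlay Ω I J) (ω : Ω) : ℝ :=
  ∑ n ∈ Finset.range N, lam * (1 - lam) ^ n * G.stagePayoff σ τ n h ω

theorem partialPayoff_succ (G : StochasticGame Ω I J) (lam : ℝ) (σ : StrategyOne Ω I J)
    (τ : StrategyTwo Ω I J) (N : ℕ) (h : PastPlay Ω I J) (ω : Ω) :
    G.partialPayoff lam σ τ (N + 1) h ω = mixedPayoff (fun i j => lam * G.g ω i j +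
      (1 - lam) * ∑ ω', G.q ω i j ω' * G.partialPayoff lam σ τ N ((ω, i, j) :: h) ω')
      (σ h ω) (τ h ω) := by
  rw [mixedPayoff_add, mixedPayoff_mul_left, mixedPayoff_mul_left, partialPayoff,
    Finset.sum_range_succ', add_comm]
  congr 1
  · simp [stagePayoff, mixedPayoff]
  · simp only [partialPayoff, stagePayoff, mixedPayoff, Finset.mul_sum]
    rw [Finset.sum_comm]
    refine Finset.sum_congr rfl fun i _ => ?_
    rw [Finset.sum_comm]
    refine Finset.sum_congr rfl fun j _ => ?_
    rw [Finset.sum_comm]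
    refine Finset.sum_congr rfl fun ω' _ => Finset.sum_congr rfl fun n _ => ?_
    ring

theorem hasSum_payoff (G : StochasticGame Ω I J) {lam : ℝ} (hlam : lam ∈ Set.Ioc (0 : ℝ) 1)
    (ω : Ω) (σ : StrategyOne Ω I J) (τ : StrategyTwo Ω I J) :
    HasSum (fun n => lam * (1 - lam) ^ n * G.stagePayoff σ τ n [] ω) (G.payoff lam ω σ τ) := by
  refine Summable.hasSum (Summable.of_nonneg_of_le (fun n => ?_) (fun n => ?_)
    (summable_geometric_of_lt_one (r := 1 - lam) (by linarith [hlam.2]) (by linarith [hlam.1])))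
  · exact mul_nonneg (mul_nonneg hlam.1.le (pow_nonneg (by linarith [hlam.2]) n))
      (G.stagePayoff_mem σ τ n [] ω).1
  · have h0 : (0 : ℝ) ≤ (1 - lam) ^ n := pow_nonneg (by linarith [hlam.2]) n
    have h1 : lam * (1 - lam) ^ n ≤ (1 - lam) ^ n := mul_le_of_le_one_left h0 hlam.2
    exact (mul_le_of_le_one_right (mul_nonneg hlam.1.le h0)
      (G.stagePayoff_mem σ τ n [] ω).2).trans h1

theorem tendsto_partialPayoff (G : StochasticGame Ω I J) {lam : ℝ}
    (hlam : lam ∈ Set.Ioc (0 : ℝ) 1) (ω : Ω) (σ : StrategyOne Ω I J) (τ : StrategyTwo Ω I J) :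
    Tendsto (fun N => G.partialPayoff lam σ τ N [] ω) atTop (𝓝 (G.payoff lam ω σ τ)) :=
  (G.hasSum_payoff hlam ω σ τ).tendsto_sum_nat

theorem tendsto_discount_pow {lam : ℝ} (hlam : lam ∈ Set.Ioc (0 : ℝ) 1) (c : ℝ) :
    Tendsto (fun N : ℕ => (1 - lam) ^ N * c) atTop (𝓝 0) := by
  simpa using (tendsto_pow_atTop_nhds_zero_of_lt_one (r := 1 - lam) (by linarith [hlam.2])
    (by linarith [hlam.1])).mul_const c

/-- A function that the pair `(σ, τ)` does not decrease in the auxiliary games, whatever the past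
play, is a lower bound of the payoff. -/
theorem le_payoff_of_le_oneShot (G : StochasticGame Ω I J) {lam : ℝ}
    (hlam : lam ∈ Set.Ioc (0 : ℝ) 1) (σ : StrategyOne Ω I J) (τ : StrategyTwo Ω I J) (w : Ω → ℝ)
    (hw : ∀ h ω, w ω ≤ mixedPayoff (G.oneShot lam w ω) (σ h ω) (τ h ω)) (ω : Ω) :
    w ω ≤ G.payoff lam ω σ τ := by
  obtain ⟨C, hC⟩ := (Set.finite_range w).bddAbove
  have key : ∀ N h ω, w ω - (1 - lam) ^ N * C ≤ G.partialPayoff lam σ τ N h ω := by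
    intro N
    induction N with
    | zero =>
      intro h ω
      simpa [partialPayoff] using hC (Set.mem_range_self ω)
    | succ N ih =>
      intro h ω
      rw [partialPayoff_succ]
      refine le_trans ?_ (mixedPayoff_mono (M := fun i j => G.oneShot lam w ω i j +
        (1 - lam) * (-((1 - lam) ^ N * C))) (fun i j => ?_) _ _)
      · rw [mixedPayoff_add, mixedPayoff_const, pow_succ]
        linarith [hw h ω]
      · rw [← oneShot_add_const]
        refine add_le_add_right (mul_le_mul_of_nonneg_left (Finset.sum_le_sum fun ω' _ => ?_)
          (sub_nonneg.2 hlam.2)) _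
        refine mul_le_mul_of_nonneg_left ?_ ((G.q ω i j).2.1 ω')
        linarith [ih ((ω, i, j) :: h) ω']
  have hlim := (tendsto_const_nhds (x := w ω)).sub (tendsto_discount_pow hlam C)
  rw [sub_zero] at hlim
  exact le_of_tendsto_of_tendsto' hlim (G.tendsto_partialPayoff hlam ω σ τ) fun N => key N [] ω

/-- The counterpart of `le_payoff_of_le_oneShot` for upper bounds. -/
theorem payoff_le_of_oneShot_le (G : StochasticGame Ω I J) {lam : ℝ}
    (hlam : lam ∈ Set.Ioc (0 : ℝ) 1) (σ : StrategyOne Ω I J) (τ : StrategyTwo Ω I J) (w : Ω → ℝ)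
    (hw : ∀ h ω, mixedPayoff (G.oneShot lam w ω) (σ h ω) (τ h ω) ≤ w ω) (ω : Ω) :
    G.payoff lam ω σ τ ≤ w ω := by
  obtain ⟨C, hC⟩ := (Set.finite_range fun ω => -w ω).bddAbove
  have key : ∀ N h ω, G.partialPayoff lam σ τ N h ω ≤ w ω + (1 - lam) ^ N * C := by
    intro N
    induction N with
    | zero =>
      intro h ω
      have := hC (Set.mem_range_self ω)
      simp only [partialPayoff, Finset.range_zero, Finset.sum_empty, pow_zero, one_mul]
      linarith
    | succ N ih =>
      intro h ω
      rw [partialPayoff_succ]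
      refine (mixedPayoff_mono (N := fun i j => G.oneShot lam w ω i j +
        (1 - lam) * ((1 - lam) ^ N * C)) (fun i j => ?_) _ _).trans ?_
      · rw [← oneShot_add_const]
        refine add_le_add_right (mul_le_mul_of_nonneg_left (Finset.sum_le_sum fun ω' _ => ?_)
          (sub_nonneg.2 hlam.2)) _
        exact mul_le_mul_of_nonneg_left (ih ((ω, i, j) :: h) ω') ((G.q ω i j).2.1 ω')
      · rw [mixedPayoff_add, mixedPayoff_const, pow_succ]
        linarith [hw h ω]
  have hlim := (tendsto_const_nhds (x := w ω)).add (tendsto_discount_pow hlam C)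
  rw [add_zero] at hlim
  exact le_of_tendsto_of_tendsto' (G.tendsto_partialPayoff hlam ω σ τ) hlim fun N => key N [] ω

theorem payoff_mem_Icc (G : StochasticGame Ω I J) {lam : ℝ} (hlam : lam ∈ Set.Ioc (0 : ℝ) 1)
    (ω : Ω) (σ : StrategyOne Ω I J) (τ : StrategyTwo Ω I J) :
    G.payoff lam ω σ τ ∈ Set.Icc (0 : ℝ) 1 := by
  constructor
  · refine G.le_payoff_of_le_oneShot hlam σ τ (fun _ => 0) (fun h ω => ?_) ω
    refine le_mixedPayoff (fun i j => ?_) _ _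
    simpa [oneShot] using mul_nonneg hlam.1.le (G.g_nonneg ω i j)
  · refine G.payoff_le_of_oneShot_le hlam σ τ (fun _ => 1) (fun h ω => ?_) ω
    refine mixedPayoff_le (fun i j => ?_) _ _
    rw [oneShot, sum_q_mul_const]
    nlinarith [G.g_le_one ω i j, hlam.1]

/-- The payoff of a pair of stationary strategies solves the Bellman equation. -/
theorem payoff_stationary_eq (G : StochasticGame Ω I J) {lam : ℝ}
    (hlam : lam ∈ Set.Ioc (0 : ℝ) 1) (x : Ω → stdSimplex ℝ I) (y : Ω → stdSimplex ℝ J) (ω : Ω) :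
    G.payoff lam ω (stationaryOne x) (stationaryTwo y) = mixedPayoff
      (G.oneShot lam (fun ω' => G.payoff lam ω' (stationaryOne x) (stationaryTwo y)) ω)
      (x ω) (y ω) := by
  have hforget : ∀ N h ω, G.partialPayoff lam (stationaryOne x) (stationaryTwo y) N h ω =
      G.partialPayoff lam (stationaryOne x) (stationaryTwo y) N [] ω := by
    intro N
    induction N with
    | zero => intro h ω; simp [partialPayoff]
    | succ N ih =>
      intro h ω
      rw [partialPayoff_succ, partialPayoff_succ]
      have : ∀ i j ω', G.partialPayoff lam (stationaryOne x) (stationaryTwo y) N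
          ((ω, i, j) :: h) ω' = G.partialPayoff lam (stationaryOne x) (stationaryTwo y) N
          [(ω, i, j)] ω' := fun i j ω' => (ih _ ω').trans (ih _ ω').symm
      simp only [this]
      rfl
  refine tendsto_nhds_unique ((tendsto_add_atTop_iff_nat 1).2
    (G.tendsto_partialPayoff hlam ω (stationaryOne x) (stationaryTwo y))) ?_
  simp only [partialPayoff_succ]
  simp only [fun N i j => hforget N [(ω, i, j)], mixedPayoff, oneShot]
  refine tendsto_finsetSum _ fun i _ => tendsto_finsetSum _ fun j _ =>
    Tendsto.const_mul _ (Tendsto.const_add _ (Tendsto.const_mul _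
      (tendsto_finsetSum _ fun ω' _ => Tendsto.const_mul _ ?_)))
  exact G.tendsto_partialPayoff hlam ω' _ _

end StochasticGame

/-! ### Optimal strategies in the discounted game -/

section PureActions

variable {I J : Type*} [Fintype I] [Fintype J]

open Classical in
/-- The mixed action that plays `j` with probability one. -/
noncomputable def pureAction (j : J) : stdSimplex ℝ J :=
  ⟨Pi.single j 1, single_mem_stdSimplex ℝ j⟩

theorem mixedPayoff_pureAction (M : I → J → ℝ) (x : stdSimplex ℝ I) (j : J) :
    mixedPayoff M x (pureAction j) = ∑ i, x i * M i j := by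
  classical
  refine Finset.sum_congr rfl fun i _ => ?_
  rw [Finset.sum_eq_single j]
  · have : pureAction j j = (1 : ℝ) := by
      change (Pi.single j 1 : J → ℝ) j = 1
      simp
    rw [this, mul_one]
  · intro j' _ hj'
    have : pureAction j j' = (0 : ℝ) := by
      change (Pi.single j 1 : J → ℝ) j' = 0
      simp [hj']
    rw [this, mul_zero, zero_mul]
  · simp

theorem mixedPayoff_eq_sum_pureAction (M : I → J → ℝ) (x : stdSimplex ℝ I) (y : stdSimplex ℝ J) :
    mixedPayoff M x y = ∑ j, y j * mixedPayoff M x (pureAction j) := by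
  simp only [mixedPayoff_pureAction, Finset.mul_sum]
  rw [mixedPayoff, Finset.sum_comm]
  exact Finset.sum_congr rfl fun j _ => Finset.sum_congr rfl fun i _ => by ring

end PureActions

namespace StochasticGame

variable {Ω I J : Type*} [Fintype Ω] [Fintype I] [Fintype J]

/-- The value of a matrix game is nonexpansive, so that Shapley's operator is a contraction. -/
theorem exists_shapley_fixedPoint [Nonempty I] [Nonempty J] (G : StochasticGame Ω I J) {lam : ℝ}
    (hlam : lam ∈ Set.Ioc (0 : ℝ) 1) :
    ∃ (w : Ω → ℝ) (x : Ω → stdSimplex ℝ I) (y : Ω → stdSimplex ℝ J),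
      (∀ ω y', w ω ≤ mixedPayoff (G.oneShot lam w ω) (x ω) y') ∧
      ∀ ω x', mixedPayoff (G.oneShot lam w ω) x' (y ω) ≤ w ω := by
  choose V X Y hX hY using fun M : I → J → ℝ => exists_optimal_mixed M
  have hle : ∀ (w w' : Ω → ℝ) (ω : Ω), V (G.oneShot lam w ω) ≤
      V (G.oneShot lam w' ω) + (1 - lam) * dist w w' := by
    intro w w' ω
    set M := G.oneShot lam w ω
    set M' := G.oneShot lam w' ω
    have h1 : ∀ i j, M i j ≤ M' i j + (1 - lam) * dist w w' := fun i j => by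
      rw [← oneShot_add_const]
      refine G.oneShot_mono hlam.2 (fun ω' => ?_) ω i j
      have := (le_abs_self _).trans ((Real.dist_eq (w ω') (w' ω')).symm.le.trans
        (dist_le_pi_dist w w' ω'))
      linarith
    calc V M ≤ mixedPayoff M (X M) (Y M') := hX M _
      _ ≤ _ := mixedPayoff_mono h1 _ _
      _ = mixedPayoff M' (X M) (Y M') + (1 - lam) * dist w w' := by
        rw [mixedPayoff_add, mixedPayoff_const]
      _ ≤ _ := add_le_add_left (hY M' _) _
  have hcontr : ContractingWith (1 - lam).toNNReal
      (fun (w : Ω → ℝ) ω => V (G.oneShot lam w ω)) := by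
    refine ⟨Real.toNNReal_lt_one.2 (sub_lt_self 1 hlam.1),
      LipschitzWith.of_dist_le_mul fun w w' => ?_⟩
    · refine (dist_pi_le_iff (mul_nonneg (NNReal.coe_nonneg _) dist_nonneg)).2 fun ω => ?_
      rw [Real.dist_eq, abs_sub_le_iff, Real.coe_toNNReal _ (sub_nonneg.2 hlam.2)]
      have h1 := hle w w' ω
      have h2 := hle w' w ω
      rw [dist_comm w' w] at h2
      exact ⟨by linarith, by linarith⟩
  have hfix := hcontr.fixedPoint_isFixedPt
  set w := ContractingWith.fixedPoint _ hcontr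
  have hw : ∀ ω, V (G.oneShot lam w ω) = w ω := congrFun hfix
  exact ⟨w, fun ω => X (G.oneShot lam w ω), fun ω => Y (G.oneShot lam w ω),
    fun ω y' => by rw [← hw ω]; exact hX _ y', fun ω x' => by rw [← hw ω]; exact hY _ x'⟩

theorem isValue_of_optimal (G : StochasticGame Ω I J) {lam : ℝ} (hlam : lam ∈ Set.Ioc (0 : ℝ) 1)
    {ω : Ω} {w : ℝ} {σ₀ : StrategyOne Ω I J} {τ₀ : StrategyTwo Ω I J}
    (hσ : ∀ τ, w ≤ G.payoff lam ω σ₀ τ) (hτ : ∀ σ, G.payoff lam ω σ τ₀ ≤ w) :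
    G.IsValue lam ω w := by
  have : Nonempty (StrategyOne Ω I J) := ⟨σ₀⟩
  have : Nonempty (StrategyTwo Ω I J) := ⟨τ₀⟩
  have hbelow : ∀ σ, BddBelow (Set.range fun τ => G.payoff lam ω σ τ) := fun σ =>
    ⟨0, by rintro _ ⟨τ, rfl⟩; exact (G.payoff_mem_Icc hlam ω σ τ).1⟩
  have habove : ∀ τ, BddAbove (Set.range fun σ => G.payoff lam ω σ τ) := fun τ =>
    ⟨1, by rintro _ ⟨σ, rfl⟩; exact (G.payoff_mem_Icc hlam ω σ τ).2⟩
  have hinf : ∀ σ, ⨅ τ, G.payoff lam ω σ τ ≤ w := fun σ => (ciInf_le (hbelow σ) τ₀).trans (hτ σ)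
  have hsup : ∀ τ, w ≤ ⨆ σ, G.payoff lam ω σ τ := fun τ => (hσ τ).trans (le_ciSup (habove τ) σ₀)
  constructor
  · refine le_antisymm (ciSup_le hinf) ((le_ciInf hσ).trans (le_ciSup
      (f := fun σ => ⨅ τ, G.payoff lam ω σ τ) ⟨w, ?_⟩ σ₀))
    rintro _ ⟨σ, rfl⟩
    exact hinf σ
  · refine le_antisymm ((ciInf_le (f := fun τ => ⨆ σ, G.payoff lam ω σ τ) ⟨w, ?_⟩ τ₀).trans
      (ciSup_le hτ)) (le_ciInf hsup)
    rintro _ ⟨τ, rfl⟩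
    exact hsup τ

/-- The mixed action that plays the uniform distribution with probability `t` and `x` otherwise. -/
noncomputable def mixUniform [Nonempty I] (t : ℝ) (ht : t ∈ Set.Icc (0 : ℝ) 1)
    (x : stdSimplex ℝ I) : stdSimplex ℝ I :=
  ⟨fun i => (1 - t) * x i + t * (Fintype.card I : ℝ)⁻¹, fun i => add_nonneg
    (mul_nonneg (sub_nonneg.2 ht.2) (x.2.1 i)) (mul_nonneg ht.1 (by positivity)), by
    have h : ∑ i, x i = 1 := x.2.2
    rw [Finset.sum_add_distrib, ← Finset.mul_sum, h, Finset.sum_const, Finset.card_univ,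
      nsmul_eq_mul]
    field_simp
    ring⟩

theorem mixUniform_pos [Nonempty I] {t : ℝ} (ht : t ∈ Set.Icc (0 : ℝ) 1) (ht0 : 0 < t)
    (x : stdSimplex ℝ I) (i : I) : 0 < mixUniform t ht x i :=
  add_pos_of_nonneg_of_pos (mul_nonneg (sub_nonneg.2 ht.2) (x.2.1 i)) (by positivity)

theorem le_mixedPayoff_mixUniform [Nonempty I] {t : ℝ} (ht : t ∈ Set.Icc (0 : ℝ) 1)
    {M : I → J → ℝ} (hM : ∀ i j, 0 ≤ M i j) (x : stdSimplex ℝ I) (y : stdSimplex ℝ J) :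
    (1 - t) * mixedPayoff M x y ≤ mixedPayoff M (mixUniform t ht x) y := by
  simp only [mixedPayoff, Finset.mul_sum]
  refine Finset.sum_le_sum fun i _ => Finset.sum_le_sum fun j _ => ?_
  have h1 : 0 ≤ t * (Fintype.card I : ℝ)⁻¹ * y j * M i j :=
    mul_nonneg (mul_nonneg (mul_nonneg ht.1 (by positivity)) (y.2.1 j)) (hM i j)
  have h2 : mixUniform t ht x i = (1 - t) * x i + t * (Fintype.card I : ℝ)⁻¹ := rfl
  rw [h2]
  linarith

/-- The discounted game has a value, player 2 has a stationary optimal strategy, and player 1 has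
a fully supported stationary strategy that is optimal up to `lam`: mixing an optimal one with the
uniform distribution with weight `lam ^ 2` costs at most `lam ^ 2` per stage, hence `lam` overall. -/
theorem exists_value_of_discounted [Nonempty I] [Nonempty J] (G : StochasticGame Ω I J) {lam : ℝ}
    (hlam : lam ∈ Set.Ioc (0 : ℝ) 1) :
    ∃ (w : Ω → ℝ) (x : Ω → stdSimplex ℝ I) (y : Ω → stdSimplex ℝ J),
      (∀ ω, G.IsValue lam ω (w ω)) ∧ (∀ ω, w ω ∈ Set.Icc (0 : ℝ) 1) ∧
      (∀ ω i, 0 < x ω i) ∧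
      (∀ τ ω, w ω - lam ≤ G.payoff lam ω (stationaryOne x) τ) ∧
      ∀ σ ω, G.payoff lam ω σ (stationaryTwo y) ≤ w ω := by
  obtain ⟨w, x, y, hx, hy⟩ := G.exists_shapley_fixedPoint hlam
  have hσ : ∀ τ ω, w ω ≤ G.payoff lam ω (stationaryOne x) τ := fun τ =>
    G.le_payoff_of_le_oneShot hlam _ τ w fun h ω => hx ω (τ h ω)
  have hτ : ∀ σ ω, G.payoff lam ω σ (stationaryTwo y) ≤ w ω := fun σ =>
    G.payoff_le_of_oneShot_le hlam σ _ w fun h ω => hy ω (σ h ω)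
  have hw : ∀ ω, w ω ∈ Set.Icc (0 : ℝ) 1 := fun ω =>
    ⟨(G.payoff_mem_Icc hlam ω (stationaryOne x) (stationaryTwo y)).1.trans (hτ _ ω),
      (hσ _ ω).trans (G.payoff_mem_Icc hlam ω (stationaryOne x) (stationaryTwo y)).2⟩
  have ht : lam ^ 2 ∈ Set.Icc (0 : ℝ) 1 := ⟨sq_nonneg _, pow_le_one₀ hlam.1.le hlam.2⟩
  refine ⟨w, fun ω => mixUniform (lam ^ 2) ht (x ω), y, fun ω => G.isValue_of_optimal hlam
    (fun τ => hσ τ ω) (fun σ => hτ σ ω), hw,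
    fun ω i => mixUniform_pos ht (pow_pos hlam.1 2) _ i, fun τ ω => ?_, hτ⟩
  refine G.le_payoff_of_le_oneShot hlam (stationaryOne fun ω => mixUniform (lam ^ 2) ht (x ω)) τ
    (fun ω => w ω - lam) (fun h ω => ?_) ω
  have hM : ∀ i j, 0 ≤ G.oneShot lam w ω i j := fun i j =>
    add_nonneg (mul_nonneg hlam.1.le (G.g_nonneg ω i j)) (mul_nonneg (sub_nonneg.2 hlam.2)
      (Finset.sum_nonneg fun ω' _ => mul_nonneg ((G.q ω i j).2.1 ω') (hw ω').1))
  have h1 := le_mixedPayoff_mixUniform ht hM (x ω) (τ h ω)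
  have h2 := mul_le_mul_of_nonneg_left (hx ω (τ h ω)) (sub_nonneg.2 ht.2)
  have h3 : mixedPayoff (G.oneShot lam (fun ω => w ω - lam) ω)
      (mixUniform (lam ^ 2) ht (x ω)) (τ h ω) =
      mixedPayoff (G.oneShot lam w ω) (mixUniform (lam ^ 2) ht (x ω)) (τ h ω) +
        (1 - lam) * (-lam) := by
    rw [← mixedPayoff_const ((1 - lam) * (-lam)) (mixUniform (lam ^ 2) ht (x ω)) (τ h ω),
      ← mixedPayoff_add]
    congr 1
    funext i j
    exact G.oneShot_add_const lam w (-lam) ω i j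
  change w ω - lam ≤ mixedPayoff _ (mixUniform (lam ^ 2) ht (x ω)) (τ h ω)
  rw [h3]
  nlinarith [(hw ω).2, mul_le_mul_of_nonneg_left (hw ω).2 ht.1]

/-- Against a stationary strategy, player 2 has a best reply that is stationary and pure: a pure
stationary strategy that minimizes the sum of the payoffs over the initial states, since it would
otherwise be improved by changing the action at one state. -/
theorem exists_pure_bestReply [Nonempty J] (G : StochasticGame Ω I J) {lam : ℝ}
    (hlam : lam ∈ Set.Ioc (0 : ℝ) 1) (x : Ω → stdSimplex ℝ I) :
    ∃ b : Ω → J, ∀ τ ω,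
      G.payoff lam ω (stationaryOne x) (stationaryTwo fun ω' => pureAction (b ω')) ≤
        G.payoff lam ω (stationaryOne x) τ := by
  classical
  let P : (Ω → J) → Ω → ℝ := fun b ω =>
    G.payoff lam ω (stationaryOne x) (stationaryTwo fun ω' => pureAction (b ω'))
  have hP : ∀ b ω, P b ω = mixedPayoff (G.oneShot lam (P b) ω) (x ω) (pureAction (b ω)) :=
    fun b ω => G.payoff_stationary_eq hlam x _ ω
  obtain ⟨b, hb⟩ := Finite.exists_min fun b => ∑ ω, P b ω
  have key : ∀ ω j, P b ω ≤ mixedPayoff (G.oneShot lam (P b) ω) (x ω) (pureAction j) := by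
    intro ω₀ j₀
    by_contra! hlt
    let b' := Function.update b ω₀ j₀
    have hle : ∀ ω, P b' ω ≤ P b ω := by
      refine G.payoff_le_of_oneShot_le hlam _ _ (P b) fun _ ω => ?_
      change mixedPayoff _ (x ω) (pureAction (b' ω)) ≤ _
      by_cases hω : ω = ω₀
      · subst hω
        simpa [b'] using hlt.le
      · simpa [b', hω] using (hP b ω).ge
    have hlt' : P b' ω₀ < P b ω₀ := by
      refine lt_of_le_of_lt ?_ hlt
      rw [hP b' ω₀]
      simp only [b', Function.update_self]
      exact mixedPayoff_mono (G.oneShot_mono hlam.2 hle ω₀) _ _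
    exact (hb b').not_gt (Finset.sum_lt_sum (fun ω _ => hle ω) ⟨ω₀, Finset.mem_univ _, hlt'⟩)
  refine ⟨b, fun τ ω => G.le_payoff_of_le_oneShot hlam _ τ (P b) (fun h ω => ?_) ω⟩
  have h1 : ∑ j, τ h ω j = 1 := (τ h ω).2.2
  rw [mixedPayoff_eq_sum_pureAction]
  calc P b ω = ∑ j, τ h ω j * P b ω := by rw [← Finset.sum_mul, h1, one_mul]
    _ ≤ _ := Finset.sum_le_sum fun j _ => mul_le_mul_of_nonneg_left (key ω j) ((τ h ω).2.1 j)

end StochasticGame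

/-! ### Subtraction-free rational functions and state elimination -/

/-- A function is subtraction-free if, at the positive points, it is a quotient of two polynomials
with nonnegative coefficients, the denominator being positive there. -/
def SubtractionFree {σ : Type*} (f : (σ → ℝ) → ℝ) : Prop :=
  ∃ A B : MvPolynomial σ NNReal, ∀ z : σ → ℝ, (∀ s, 0 < z s) →
    0 < MvPolynomial.aeval z B ∧ f z = MvPolynomial.aeval z A / MvPolynomial.aeval z B

namespace SubtractionFree

variable {σ : Type*} {f f' : (σ → ℝ) → ℝ}

theorem const {c : ℝ} (hc : 0 ≤ c) : SubtractionFree fun _ : σ → ℝ => c :=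
  ⟨MvPolynomial.C c.toNNReal, 1, fun z _ => by
    rw [map_one, div_one, MvPolynomial.aeval_C]
    exact ⟨one_pos, (Real.coe_toNNReal c hc).symm⟩⟩

theorem coord (s : σ) : SubtractionFree fun z : σ → ℝ => z s :=
  ⟨MvPolynomial.X s, 1, fun z _ => by simp⟩

theorem add (hf : SubtractionFree f) (hf' : SubtractionFree f') :
    SubtractionFree fun z => f z + f' z := by
  obtain ⟨A, B, h⟩ := hf
  obtain ⟨A', B', h'⟩ := hf'
  refine ⟨A * B' + B * A', B * B', fun z hz => ?_⟩
  obtain ⟨hB, hA⟩ := h z hz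
  obtain ⟨hB', hA'⟩ := h' z hz
  simp only [map_mul, map_add]
  exact ⟨mul_pos hB hB', by rw [hA, hA', div_add_div _ _ hB.ne' hB'.ne']⟩

theorem mul (hf : SubtractionFree f) (hf' : SubtractionFree f') :
    SubtractionFree fun z => f z * f' z := by
  obtain ⟨A, B, h⟩ := hf
  obtain ⟨A', B', h'⟩ := hf'
  refine ⟨A * A', B * B', fun z hz => ?_⟩
  obtain ⟨hB, hA⟩ := h z hz
  obtain ⟨hB', hA'⟩ := h' z hz
  simp only [map_mul]
  exact ⟨mul_pos hB hB', by rw [hA, hA', div_mul_div_comm]⟩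

theorem div (hf : SubtractionFree f) (hf' : SubtractionFree f')
    (hpos : ∀ z : σ → ℝ, (∀ s, 0 < z s) → 0 < f' z) : SubtractionFree fun z => f z / f' z := by
  obtain ⟨A, B, h⟩ := hf
  obtain ⟨A', B', h'⟩ := hf'
  refine ⟨A * B', B * A', fun z hz => ?_⟩
  obtain ⟨hB, hA⟩ := h z hz
  obtain ⟨hB', hA'⟩ := h' z hz
  have hpos' : 0 < MvPolynomial.aeval z A' := by
    have := hpos z hz
    rw [hA'] at this
    exact (div_pos_iff_of_pos_right hB').1 this
  simp only [map_mul]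
  exact ⟨mul_pos hB hpos', by rw [hA, hA', div_div_div_eq]⟩

theorem sum {ι : Type*} (s : Finset ι) {F : ι → (σ → ℝ) → ℝ}
    (h : ∀ i ∈ s, SubtractionFree (F i)) : SubtractionFree fun z => ∑ i ∈ s, F i z := by
  classical
  induction s using Finset.induction_on with
  | empty => simpa using const (σ := σ) le_rfl
  | insert a s ha ih =>
    simp only [Finset.sum_insert ha]
    exact (h a (Finset.mem_insert_self a s)).add
      (ih fun i hi => h i (Finset.mem_insert_of_mem hi))

theorem nonneg (hf : SubtractionFree f) {z : σ → ℝ} (hz : ∀ s, 0 < z s) : 0 ≤ f z := by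
  obtain ⟨A, B, h⟩ := hf
  obtain ⟨hB, hA⟩ := h z hz
  rw [hA]
  refine div_nonneg ?_ hB.le
  rw [MvPolynomial.aeval_def, MvPolynomial.eval₂_eq]
  exact Finset.sum_nonneg fun d _ => mul_nonneg (NNReal.coe_nonneg _)
    (Finset.prod_nonneg fun s _ => pow_nonneg (hz s).le _)

end SubtractionFree

/-- The linear system of a Markov chain on the finite set `S` of states that moves from `ω` to
`ω'` at rate `P ω ω'`, is killed at rate `K ω` and earns `R ω`. -/
def ChainSystem {Ω : Type*} [DecidableEq Ω] (S : Finset Ω) (K R : Ω → ℝ) (P : Ω → Ω → ℝ)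
    (w : Ω → ℝ) : Prop :=
  ∀ ω ∈ S, (K ω + ∑ ω' ∈ S.erase ω, P ω ω') * w ω = R ω + ∑ ω' ∈ S.erase ω, P ω ω' * w ω'

/-- Elimination of the state `s` from the system of a killed Markov chain: the rates are those of
the chain watched outside `s`. -/
theorem ChainSystem.eliminate {Ω : Type*} [DecidableEq Ω] {S : Finset Ω} {s : Ω} (hs : s ∉ S)
    {K R : Ω → ℝ} {P : Ω → Ω → ℝ} {w : Ω → ℝ} (hD : K s + ∑ ω' ∈ S, P s ω' ≠ 0)
    (h : ChainSystem (insert s S) K R P w) :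
    w s = (R s + ∑ ω' ∈ S, P s ω' * w ω') / (K s + ∑ ω' ∈ S, P s ω') ∧
    ChainSystem S (fun ω => K ω + P ω s * K s / (K s + ∑ ω' ∈ S, P s ω'))
      (fun ω => R ω + P ω s * R s / (K s + ∑ ω' ∈ S, P s ω'))
      (fun ω ω' => P ω ω' + P ω s * P s ω' / (K s + ∑ ω' ∈ S, P s ω')) w := by
  set D := K s + ∑ ω' ∈ S, P s ω' with hDdef
  have hws : D * w s = R s + ∑ ω' ∈ S, P s ω' * w ω' := by
    have := h s (Finset.mem_insert_self s S)
    rwa [Finset.erase_insert hs] at this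
  have hws' : w s = (R s + ∑ ω' ∈ S, P s ω' * w ω') / D := by
    rw [eq_div_iff hD, mul_comm, hws]
  refine ⟨hws', fun ω hω => ?_⟩
  have hne : s ≠ ω := fun h => hs (h ▸ hω)
  have hsω : s ∉ S.erase ω := fun h => hs (Finset.mem_of_mem_erase h)
  have h1 := h ω (Finset.mem_insert_of_mem hω)
  rw [Finset.erase_insert_of_ne hne, Finset.sum_insert hsω, Finset.sum_insert hsω] at h1
  have h2 : ∑ ω' ∈ S, P s ω' = P s ω + ∑ ω' ∈ S.erase ω, P s ω' :=
    (Finset.add_sum_erase S _ hω).symm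
  have h3 : ∑ ω' ∈ S, P s ω' * w ω' = P s ω * w ω + ∑ ω' ∈ S.erase ω, P s ω' * w ω' :=
    (Finset.add_sum_erase S (fun ω' => P s ω' * w ω') hω).symm
  have h4 : ∑ ω' ∈ S.erase ω, (P ω ω' + P ω s * P s ω' / D) =
      ∑ ω' ∈ S.erase ω, P ω ω' + P ω s * (∑ ω' ∈ S.erase ω, P s ω') / D := by
    rw [Finset.sum_add_distrib, Finset.mul_sum, Finset.sum_div]
  have h5 : ∑ ω' ∈ S.erase ω, (P ω ω' + P ω s * P s ω' / D) * w ω' =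
      ∑ ω' ∈ S.erase ω, P ω ω' * w ω' +
        P ω s * (∑ ω' ∈ S.erase ω, P s ω' * w ω') / D := by
    rw [Finset.mul_sum, Finset.sum_div, ← Finset.sum_add_distrib]
    exact Finset.sum_congr rfl fun ω' _ => by ring
  change (K ω + P ω s * K s / D + ∑ ω' ∈ S.erase ω, (P ω ω' + P ω s * P s ω' / D)) * w ω =
    R ω + P ω s * R s / D + ∑ ω' ∈ S.erase ω, (P ω ω' + P ω s * P s ω' / D) * w ω'
  rw [h4, h5]
  rw [h2] at hDdef
  rw [h3] at hws
  clear_value D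
  field_simp
  linear_combination D * h1 + P ω s * hws - P ω s * w ω * hDdef

/-- The system of a killed Markov chain whose data are subtraction-free has a subtraction-free
solution: eliminating the states one by one never needs a subtraction. -/
theorem exists_subtractionFree_solution {σ Ω : Type*} [DecidableEq Ω] (S : Finset Ω)
    (K R : Ω → (σ → ℝ) → ℝ) (P : Ω → Ω → (σ → ℝ) → ℝ)
    (hK : ∀ ω, SubtractionFree (K ω)) (hK0 : ∀ ω z, (∀ s, 0 < z s) → 0 < K ω z)
    (hR : ∀ ω, SubtractionFree (R ω)) (hP : ∀ ω ω', SubtractionFree (P ω ω')) :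
    ∀ ω ∈ S, ∃ f : (σ → ℝ) → ℝ, SubtractionFree f ∧ ∀ z, (∀ s, 0 < z s) → ∀ w : Ω → ℝ,
      ChainSystem S (fun ω => K ω z) (fun ω => R ω z) (fun ω ω' => P ω ω' z) w → w ω = f z := by
  induction S using Finset.induction_on generalizing K R P with
  | empty => simp
  | insert s S hs ih =>
    let D : (σ → ℝ) → ℝ := fun z => K s z + ∑ ω' ∈ S, P s ω' z
    have hD : SubtractionFree D := (hK s).add (SubtractionFree.sum S fun ω' _ => hP s ω')
    have hD0 : ∀ z : σ → ℝ, (∀ s, 0 < z s) → 0 < D z := fun z hz =>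
      add_pos_of_pos_of_nonneg (hK0 s z hz) (Finset.sum_nonneg fun ω' _ => (hP s ω').nonneg hz)
    have hrec := ih (fun ω z => K ω z + P ω s z * K s z / D z)
      (fun ω z => R ω z + P ω s z * R s z / D z)
      (fun ω ω' z => P ω ω' z + P ω s z * P s ω' z / D z)
      (fun ω => (hK ω).add (((hP ω s).mul (hK s)).div hD hD0))
      (fun ω z hz => add_pos_of_pos_of_nonneg (hK0 ω z hz)
        ((((hP ω s).mul (hK s)).div hD hD0).nonneg hz))
      (fun ω => (hR ω).add (((hP ω s).mul (hR s)).div hD hD0))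
      (fun ω ω' => (hP ω ω').add (((hP ω s).mul (hP s ω')).div hD hD0))
    choose! F hF hFw using hrec
    intro ω hω
    rcases Finset.mem_insert.1 hω with rfl | hω
    · refine ⟨fun z => (R ω z + ∑ ω' ∈ S, P ω ω' z * F ω' z) / D z,
        ((hR ω).add (SubtractionFree.sum S fun ω' hω' => (hP ω ω').mul (hF ω' hω'))).div hD hD0,
        fun z hz w hw => ?_⟩
      obtain ⟨h1, h2⟩ := hw.eliminate hs (hD0 z hz).ne'
      rw [h1]
      congr 2
      exact Finset.sum_congr rfl fun ω' hω' => by rw [hFw ω' hω' z hz w h2]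
    · exact ⟨F ω, hF ω hω, fun z hz w hw =>
        hFw ω hω z hz w (hw.eliminate hs (hD0 z hz).ne').2⟩

/-! ### Exponents and coefficients reproducing the limits along an ultrafilter -/

/-- The linear form `δ ↦ ∑ s, δ s * a s`; when `a s` is the logarithm of `z s`, it is the logarithm
of the monomial with exponents `δ`. -/
def pairing {σ : Type*} [Fintype σ] (δ a : σ → ℝ) : ℝ := ∑ s, δ s * a s

section Pairing

variable {σ : Type*} [Fintype σ]

theorem pairing_add_left (δ δ' a : σ → ℝ) : pairing (δ + δ') a = pairing δ a + pairing δ' a := by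
  simp [pairing, add_mul, Finset.sum_add_distrib]

theorem pairing_smul_left (c : ℝ) (δ a : σ → ℝ) : pairing (c • δ) a = c * pairing δ a := by
  simp [pairing, mul_assoc, Finset.mul_sum]

theorem pairing_single_one [DecidableEq σ] (s : σ) (a : σ → ℝ) :
    pairing (Pi.single s 1) a = a s := by
  simp [pairing, Pi.single_apply]

theorem linearMap_eq_pairing [DecidableEq σ] (f : (σ → ℝ) →ₗ[ℝ] ℝ) (δ : σ → ℝ) :
    f δ = pairing δ fun s => f (Pi.single s 1) := by
  rw [LinearMap.pi_apply_eq_sum_univ f δ]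
  refine Finset.sum_congr rfl fun s _ => ?_
  rw [smul_eq_mul]
  congr 2
  funext j
  simp [Pi.single_apply, eq_comm]

variable {α β : Type*}

/-- The vectors whose pairing with `ℓ` has a finite limit along `U`. -/
def finiteLimits (U : Ultrafilter α) (ℓ : α → σ → ℝ) : Submodule ℝ (σ → ℝ) where
  carrier := {δ | ∃ r, Tendsto (fun a => pairing δ (ℓ a)) U (𝓝 r)}
  add_mem' := by
    rintro δ δ' ⟨r, hr⟩ ⟨r', hr'⟩
    exact ⟨r + r', by simpa only [pairing_add_left] using hr.add hr'⟩
  zero_mem' := ⟨0, by simp [pairing]⟩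
  smul_mem' := by
    rintro c δ ⟨r, hr⟩
    exact ⟨c * r, by simpa only [pairing_smul_left] using hr.const_mul c⟩

theorem exists_linearMap_eq_limit (U : Ultrafilter α) (ℓ : α → σ → ℝ) :
    ∃ D : finiteLimits U ℓ →ₗ[ℝ] ℝ, ∀ δ : finiteLimits U ℓ,
      Tendsto (fun a => pairing δ.1 (ℓ a)) U (𝓝 (D δ)) := by
  choose D hD using fun δ : finiteLimits U ℓ => δ.2
  refine ⟨⟨⟨D, fun δ δ' => ?_⟩, fun c δ => ?_⟩, hD⟩
  · refine tendsto_nhds_unique (hD (δ + δ')) ?_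
    simpa only [Submodule.coe_add, pairing_add_left] using (hD δ).add (hD δ')
  · refine tendsto_nhds_unique (hD (c • δ)) ?_
    simpa only [Submodule.coe_smul, pairing_smul_left, RingHom.id_apply, smul_eq_mul]
      using (hD δ).const_mul c

theorem convex_tendsto_atBot (U : Ultrafilter α) (ℓ : α → σ → ℝ) :
    Convex ℝ {δ : σ → ℝ | Tendsto (fun a => pairing δ (ℓ a)) U atBot} := by
  refine convex_iff_forall_pos.2 fun δ hδ δ' hδ' c c' hc hc' _ => ?_
  simp only [Set.mem_ofPred_eq, pairing_add_left, pairing_smul_left] at *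
  exact (hδ.const_mul_atBot hc).atBot_add_atBot (hδ'.const_mul_atBot hc')

/-- Along a family `z` with `ℓ = log z`, finitely many monomials with exponents `δ ∈ T` are
modelled by a curve `s ↦ exp (d s) * t ^ e s` as `t → 0`: a monomial that tends to `0` has positive
exponent, and one that tends to `exp r` has exponent `0` and coefficient `exp r`. The exponents
separate the convex hull of the monomials that tend to `0` from the space of those with a finite
positive limit; the coefficients extend the limit, a linear form on that space. The coordinate `s₀`
is normalized to be the parameter `t` of the curve. -/
theorem exists_exponents (U : Ultrafilter α) (ℓ : α → σ → ℝ) (T : Finset (σ → ℝ)) (s₀ : σ)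
    (hs₀ : Tendsto (fun a => ℓ a s₀) U atBot) :
    ∃ e d : σ → ℝ, e s₀ = 1 ∧ d s₀ = 0 ∧ ∀ δ ∈ T,
      (Tendsto (fun a => pairing δ (ℓ a)) U atBot → 0 < pairing δ e) ∧
      ∀ r, Tendsto (fun a => pairing δ (ℓ a)) U (𝓝 r) → pairing δ e = 0 ∧ pairing δ d = r := by
  classical
  set δ₀ : σ → ℝ := Pi.single s₀ 1 with hδ₀
  let N : Set (σ → ℝ) := {δ ∈ (insert δ₀ T : Finset (σ → ℝ)) |
    Tendsto (fun a => pairing δ (ℓ a)) U atBot}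
  have hNfin : N.Finite := (insert δ₀ T).finite_toSet.subset fun δ hδ => hδ.1
  have hδ₀N : δ₀ ∈ N := ⟨Finset.mem_insert_self _ _, by simpa [hδ₀, pairing_single_one] using hs₀⟩
  have hdisj : Disjoint (convexHull ℝ N) (finiteLimits U ℓ : Set (σ → ℝ)) := by
    refine Set.disjoint_left.2 fun δ hδ hδ' => ?_
    obtain ⟨r, hr⟩ := hδ'
    exact not_tendsto_atBot_of_tendsto_nhds hr
      (convexHull_min (fun δ hδ => hδ.2) (convex_tendsto_atBot U ℓ) hδ)
  obtain ⟨f, u, v, hfu, huv, hvf⟩ := geometric_hahn_banach_compact_closed (convex_convexHull ℝ N)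
    (hNfin.isCompact_convexHull ℝ) (finiteLimits U ℓ).convex
    (Submodule.closed_of_finiteDimensional _) hdisj
  have hv : v < 0 := by simpa using hvf 0 (finiteLimits U ℓ).zero_mem
  -- A linear form bounded below on a subspace vanishes there.
  have hf0 : ∀ δ ∈ finiteLimits U ℓ, f δ = 0 := by
    intro δ hδ
    by_contra hne
    have := hvf ((v / f δ) • δ) ((finiteLimits U ℓ).smul_mem _ hδ)
    rw [map_smul, smul_eq_mul, div_mul_cancel₀ _ hne] at this
    exact lt_irrefl _ this
  have hfneg : ∀ δ ∈ N, f δ < 0 := fun δ hδ =>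
    (hfu δ (subset_convexHull ℝ N hδ)).trans (huv.trans hv)
  have hf₀ := hfneg δ₀ hδ₀N
  let E : (σ → ℝ) →ₗ[ℝ] ℝ := (f δ₀)⁻¹ • (f : (σ → ℝ) →ₗ[ℝ] ℝ)
  have hE : ∀ δ, E δ = (f δ₀)⁻¹ * f δ := fun δ => rfl
  have hE₀ : E δ₀ = 1 := by rw [hE, inv_mul_cancel₀ hf₀.ne]
  obtain ⟨D, hD⟩ := exists_linearMap_eq_limit U ℓ
  obtain ⟨D', hD'⟩ := D.exists_extend
  let D'' : (σ → ℝ) →ₗ[ℝ] ℝ := D' - D' δ₀ • E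
  have hD'' : ∀ δ, D'' δ = D' δ - D' δ₀ * E δ := fun δ => rfl
  refine ⟨fun s => E (Pi.single s 1), fun s => D'' (Pi.single s 1), hE₀, ?_, fun δ hδ =>
    ⟨fun hbot => ?_, fun r hr => ?_⟩⟩
  · change D'' δ₀ = 0
    rw [hD'', hE₀, mul_one, sub_self]
  · rw [← linearMap_eq_pairing, hE]
    exact mul_pos_of_neg_of_neg (inv_lt_zero.2 hf₀) (hfneg δ ⟨Finset.mem_insert_of_mem hδ, hbot⟩)
  · rw [← linearMap_eq_pairing, ← linearMap_eq_pairing, hD'', hE]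
    have hδ : δ ∈ finiteLimits U ℓ := ⟨r, hr⟩
    rw [hf0 δ hδ]
    refine ⟨mul_zero _, ?_⟩
    rw [mul_zero, mul_zero, sub_zero]
    have h1 : D' δ = D ⟨δ, hδ⟩ := LinearMap.congr_fun hD' ⟨δ, hδ⟩
    rw [h1]
    exact tendsto_nhds_unique (hD ⟨δ, hδ⟩) hr

/-! ### Transfer of limits of subtraction-free functions -/

/-- The monomials with exponents in `T` have the same limit in `[0, ∞)` along `F'`, with logarithms
`ℓ'`, as along `F`, with logarithms `ℓ`, whenever the latter limit exists. -/
def LimitsMatch (T : Finset (σ → ℝ)) (F : Filter α) (ℓ : α → σ → ℝ) (F' : Filter β)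
    (ℓ' : β → σ → ℝ) : Prop :=
  ∀ δ ∈ T, (Tendsto (fun a => pairing δ (ℓ a)) F atBot →
      Tendsto (fun b => pairing δ (ℓ' b)) F' atBot) ∧
    ∀ r, Tendsto (fun a => pairing δ (ℓ a)) F (𝓝 r) →
      Tendsto (fun b => pairing δ (ℓ' b)) F' (𝓝 r)

theorem tendsto_exp_of_match {F : Filter α} {F' : Filter β} {p : α → ℝ} {p' : β → ℝ}
    [F.NeBot]
    (hbot : Tendsto p F atBot → Tendsto p' F' atBot)
    (hfin : ∀ r, Tendsto p F (𝓝 r) → Tendsto p' F' (𝓝 r)) {ρ : ℝ}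
    (h : Tendsto (fun a => Real.exp (p a)) F (𝓝 ρ)) :
    Tendsto (fun b => Real.exp (p' b)) F' (𝓝 ρ) := by
  rcases (ge_of_tendsto' h fun a => (Real.exp_pos _).le).eq_or_lt with rfl | hρ
  · rw [Real.tendsto_exp_comp_nhds_zero] at h ⊢
    exact hbot h
  · have h1 := h.log hρ.ne'
    simp only [Real.log_exp] at h1
    simpa only [Real.exp_log hρ, Function.comp_def] using (Real.continuous_exp.tendsto _).comp (hfin _ h1)

theorem monomial_div_eq_exp {z : σ → ℝ} (hz : ∀ s, 0 < z s) (m m' : σ →₀ ℕ) :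
    (∏ s, z s ^ m s) / ∏ s, z s ^ m' s =
      Real.exp (pairing (fun s => (m s : ℝ) - m' s) fun s => Real.log (z s)) := by
  have h : ∀ n : σ →₀ ℕ, ∏ s, z s ^ n s = Real.exp (∑ s, n s * Real.log (z s)) := fun n => by
    rw [Real.exp_sum]
    exact Finset.prod_congr rfl fun s _ => by
      rw [Real.exp_nat_mul, Real.exp_log (hz s)]
  rw [h, h, ← Real.exp_sub, ← Finset.sum_sub_distrib]
  congr 1
  exact Finset.sum_congr rfl fun s _ => (sub_mul _ _ _).symm

theorem aeval_div_monomial (A : MvPolynomial σ NNReal) (z : σ → ℝ) (m : σ →₀ ℕ) :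
    MvPolynomial.aeval z A / ∏ s, z s ^ m s =
      ∑ n ∈ A.support, ((A.coeff n : NNReal) : ℝ) * ((∏ s, z s ^ n s) / ∏ s, z s ^ m s) := by
  rw [MvPolynomial.aeval_def, MvPolynomial.eval₂_eq', Finset.sum_div]
  exact Finset.sum_congr rfl fun n _ => mul_div_assoc _ _ _

/-- The limit of a bounded subtraction-free function along a family of points only depends on the
limits of finitely many monomials. After division by a monomial that dominates all others along
`U`, numerator and denominator have limits given by these; there is no cancellation, so the
denominator does not tend to `0`. -/
theorem SubtractionFree.exists_transfer {f : (σ → ℝ) → ℝ} (hf : SubtractionFree f) :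
    ∃ T : Finset (σ → ℝ), ∀ (U : Ultrafilter α) (z : α → σ → ℝ) (F : Filter β)
      (z' : β → σ → ℝ), (∀ᶠ a in U, ∀ s, 0 < z a s) → (∀ᶠ b in F, ∀ s, 0 < z' b s) →
      (∀ᶠ a in U, f (z a) ≤ 1) →
      LimitsMatch T U (fun a s => Real.log (z a s)) F (fun b s => Real.log (z' b s)) →
      ∃ r, Tendsto (fun a => f (z a)) U (𝓝 r) ∧ Tendsto (fun b => f (z' b)) F (𝓝 r) := by
  classical
  obtain ⟨A, B, hAB⟩ := hf
  let S := A.support ∪ B.support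
  refine ⟨(S ×ˢ S).image fun p s => (p.1 s : ℝ) - p.2 s, fun U z F z' hz hz' hle hmatch => ?_⟩
  let mon : (σ →₀ ℕ) → (σ → ℝ) → ℝ := fun m z => ∏ s, z s ^ m s
  have hmon : ∀ m {z : σ → ℝ}, (∀ s, 0 < z s) → 0 < mon m z := fun m z hz =>
    Finset.prod_pos fun s _ => pow_pos (hz s) _
  have hSne : S.Nonempty := by
    have h1 := (hAB (fun _ => 1) fun _ => one_pos).1
    by_contra hS
    have hB : B = 0 := MvPolynomial.support_eq_empty.1
      (Finset.union_eq_empty.1 (Finset.not_nonempty_iff_eq_empty.1 hS)).2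
    simp [hB] at h1
  obtain ⟨m, hmS, hm⟩ : ∃ m ∈ (S : Set (σ →₀ ℕ)), ∀ᶠ a in U, ∀ n ∈ S, mon n (z a) ≤ mon m (z a) :=
    (Ultrafilter.eventually_exists_mem_iff S.finite_toSet).1
      (Eventually.of_forall fun a => S.exists_max_image (fun n => mon n (z a)) hSne)
  have hlim : ∀ n ∈ S, ∃ ρ, Tendsto (fun a => mon n (z a) / mon m (z a)) U (𝓝 ρ) := by
    intro n hn
    have hev : ∀ᶠ a in U, mon n (z a) / mon m (z a) ∈ Set.Icc (0 : ℝ) 1 := by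
      filter_upwards [hz, hm] with a ha hma
      exact ⟨div_nonneg (hmon n ha).le (hmon m ha).le, (div_le_one (hmon m ha)).2 (hma n hn)⟩
    obtain ⟨ρ, -, hρ⟩ := isCompact_Icc.ultrafilter_le_nhds
      (U.map fun a => mon n (z a) / mon m (z a)) (le_principal_iff.2 hev)
    exact ⟨ρ, hρ⟩
  choose! ρ hρ using hlim
  have hρ' : ∀ n ∈ S, Tendsto (fun b => mon n (z' b) / mon m (z' b)) F (𝓝 (ρ n)) := by
    intro n hn
    obtain ⟨h1, h2⟩ := hmatch _ (Finset.mem_image_of_mem _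
      (Finset.mk_mem_product hn (Finset.mem_coe.1 hmS)))
    refine (tendsto_exp_of_match h1 h2 ((hρ n hn).congr' ?_)).congr' ?_
    · filter_upwards [hz] with a ha using monomial_div_eq_exp ha n m
    · filter_upwards [hz'] with b hb using (monomial_div_eq_exp hb n m).symm
  have hρ0 : ∀ n ∈ S, 0 ≤ ρ n := fun n hn => ge_of_tendsto (hρ n hn) <| by
    filter_upwards [hz] with a ha using div_nonneg (hmon n ha).le (hmon m ha).le
  have hρm : ρ m = 1 := tendsto_nhds_unique (hρ m hmS) <| tendsto_const_nhds.congr' <| by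
    filter_upwards [hz] with a ha using (div_self (hmon m ha).ne').symm
  have hlimpoly : ∀ C : MvPolynomial σ NNReal, C.support ⊆ S →
      Tendsto (fun a => MvPolynomial.aeval (z a) C / mon m (z a)) U
        (𝓝 (∑ n ∈ C.support, ((C.coeff n : NNReal) : ℝ) * ρ n)) ∧
      Tendsto (fun b => MvPolynomial.aeval (z' b) C / mon m (z' b)) F
        (𝓝 (∑ n ∈ C.support, ((C.coeff n : NNReal) : ℝ) * ρ n)) := by
    intro C hC
    simp only [mon, aeval_div_monomial]
    exact ⟨tendsto_finsetSum _ fun n hn => (hρ n (hC hn)).const_mul _,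
      tendsto_finsetSum _ fun n hn => (hρ' n (hC hn)).const_mul _⟩
  have hpospoly : ∀ C : MvPolynomial σ NNReal, C.support ⊆ S → m ∈ C.support →
      0 < ∑ n ∈ C.support, ((C.coeff n : NNReal) : ℝ) * ρ n := by
    intro C hC hmC
    refine Finset.sum_pos' (fun n hn => mul_nonneg (NNReal.coe_nonneg _) (hρ0 n (hC hn)))
      ⟨m, hmC, ?_⟩
    rw [hρm, mul_one]
    exact NNReal.coe_pos.2 (pos_iff_ne_zero.2 (MvPolynomial.mem_support_iff.1 hmC))
  obtain ⟨hA, hA'⟩ := hlimpoly A Finset.subset_union_left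
  obtain ⟨hB, hB'⟩ := hlimpoly B Finset.subset_union_right
  have hABle : ∑ n ∈ A.support, ((A.coeff n : NNReal) : ℝ) * ρ n ≤ ∑ n ∈ B.support, ((B.coeff n : NNReal) : ℝ) * ρ n := by
    refine le_of_tendsto_of_tendsto hA hB ?_
    filter_upwards [hz, hle] with a ha hfa
    obtain ⟨h1, h2⟩ := hAB _ ha
    rw [h2, div_le_one h1] at hfa
    exact div_le_div_of_nonneg_right hfa (hmon m ha).le
  have hBpos : 0 < ∑ n ∈ B.support, ((B.coeff n : NNReal) : ℝ) * ρ n := by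
    rcases Finset.mem_union.1 (Finset.mem_coe.1 hmS) with h | h
    · exact (hpospoly A Finset.subset_union_left h).trans_le hABle
    · exact hpospoly B Finset.subset_union_right h
  refine ⟨_, (hA.div hB hBpos.ne').congr' ?_, (hA'.div hB' hBpos.ne').congr' ?_⟩
  · filter_upwards [hz] with a ha
    rw [(hAB _ ha).2]
    exact div_div_div_cancel_right₀ (hmon m ha).ne' _ _
  · filter_upwards [hz'] with b hb
    rw [(hAB _ hb).2]
    exact div_div_div_cancel_right₀ (hmon m hb).ne' _ _

end Pairing

/-! ### Canonical families of stationary strategies -/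

theorem limitsMatch_of_exponents {σ α : Type*} [Fintype σ] {T : Finset (σ → ℝ)} {F : Filter α}
    {ℓ : α → σ → ℝ} {e d : σ → ℝ}
    (h : ∀ δ ∈ T, (Tendsto (fun a => pairing δ (ℓ a)) F atBot → 0 < pairing δ e) ∧
      ∀ r, Tendsto (fun a => pairing δ (ℓ a)) F (𝓝 r) → pairing δ e = 0 ∧ pairing δ d = r)
    {ℓ' : ℝ → σ → ℝ}
    (hℓ' : ∀ s, Tendsto (fun t => ℓ' t s - (d s + e s * Real.log t)) (𝓝[>] 0) (𝓝 0)) :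
    LimitsMatch T F ℓ (𝓝[>] 0) ℓ' := by
  intro δ hδ
  have hrem : Tendsto (fun t => ∑ s, δ s * (ℓ' t s - (d s + e s * Real.log t))) (𝓝[>] 0) (𝓝 0) := by
    simpa using tendsto_finsetSum Finset.univ fun s _ => (hℓ' s).const_mul (δ s)
  have hsplit : ∀ t, pairing δ (ℓ' t) = (∑ s, δ s * (ℓ' t s - (d s + e s * Real.log t))) +
      pairing δ d + pairing δ e * Real.log t := by
    intro t
    simp only [pairing, Finset.sum_mul, ← Finset.sum_add_distrib]
    exact Finset.sum_congr rfl fun s _ => by ring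
  have hrem' := hrem.add_const (pairing δ d)
  rw [zero_add] at hrem'
  refine ⟨fun hbot => ?_, fun r hr => ?_⟩
  · simp only [hsplit]
    exact hrem'.add_atBot (Real.tendsto_log_nhdsGT_zero.const_mul_atBot ((h δ hδ).1 hbot))
  · obtain ⟨he, hd⟩ := (h δ hδ).2 r hr
    rw [hd] at hrem'
    simpa only [hsplit, he, zero_mul, add_zero, hd] using hrem'

namespace CanonicalData

variable {Ω I : Type*} [Fintype I]

theorem tendsto_sum (x : CanonicalData Ω I) (ω : Ω) :
    Tendsto (fun t : ℝ => ∑ i, x.c ω i * t ^ x.e ω i) (𝓝[>] 0) (𝓝 1) := by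
  have hterm : ∀ i, Tendsto (fun t : ℝ => x.c ω i * t ^ x.e ω i) (𝓝[>] 0)
      (𝓝 (if x.e ω i = 0 then x.c ω i else 0)) := by
    intro i
    split_ifs with h
    · simp [h]
    · have := ((Real.continuousAt_rpow_const 0 (x.e ω i) (Or.inr (x.e_nonneg ω i))).tendsto.mono_left
        (nhdsWithin_le_nhds (s := Set.Ioi 0))).const_mul (x.c ω i)
      simpa [Real.zero_rpow h] using this
  have := tendsto_finsetSum Finset.univ fun i _ => hterm i
  rwa [← Finset.sum_filter, x.sum_c ω] at this

theorem strategy_pos [Nonempty I] (x : CanonicalData Ω I) {t : ℝ} (ht : 0 < t) (ω : Ω) (i : I) :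
    0 < x.strategy t ht ω i :=
  div_pos (mul_pos (x.c_pos ω i) (Real.rpow_pos_of_pos ht _)) (Finset.sum_pos
    (fun i _ => mul_pos (x.c_pos ω i) (Real.rpow_pos_of_pos ht _)) Finset.univ_nonempty)

/-- The canonical family as a function of an arbitrary real parameter; only the values at positive
parameters matter. -/
noncomputable def family [Nonempty I] (x : CanonicalData Ω I) (t : ℝ) (ω : Ω) : stdSimplex ℝ I :=
  if ht : 0 < t then x.strategy t ht ω else x.strategy 1 one_pos ω

theorem family_of_pos [Nonempty I] (x : CanonicalData Ω I) {t : ℝ} (ht : 0 < t) :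
    x.family t = x.strategy t ht := by
  funext ω
  exact dif_pos ht

theorem tendsto_log_family [Nonempty I] (x : CanonicalData Ω I) (ω : Ω) (i : I) :
    Tendsto (fun t => Real.log (x.family t ω i) -
      (Real.log (x.c ω i) + x.e ω i * Real.log t)) (𝓝[>] 0) (𝓝 0) := by
  have h := ((x.tendsto_sum ω).log one_ne_zero).neg
  rw [Real.log_one, neg_zero] at h
  refine h.congr' ?_
  filter_upwards [self_mem_nhdsWithin] with t ht
  have ht : 0 < t := ht
  have hpos : ∀ i, 0 < x.c ω i * t ^ x.e ω i := fun i =>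
    mul_pos (x.c_pos ω i) (Real.rpow_pos_of_pos ht _)
  have hval : x.family t ω i = x.c ω i * t ^ x.e ω i / ∑ i', x.c ω i' * t ^ x.e ω i' := by
    rw [x.family_of_pos ht]
    rfl
  rw [hval, Real.log_div (hpos i).ne' (Finset.sum_pos (fun i _ => hpos i) ⟨i, Finset.mem_univ i⟩).ne',
    Real.log_mul (x.c_pos ω i).ne' (Real.rpow_pos_of_pos ht _).ne', Real.log_rpow ht]
  ring

end CanonicalData

/-! ### Payoffs along ultrafilters -/

/-- The variables of the payoff of a stationary strategy: `none` stands for the ratio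
`lam / (1 - lam)`, and `some (ω, i)` for the probability of `i` at `ω`. -/
noncomputable def gamePoint {Ω I : Type*} [Fintype I] (lam : ℝ) (x : Ω → stdSimplex ℝ I) :
    Option (Ω × I) → ℝ
  | none => lam / (1 - lam)
  | some p => x p.1 p.2

theorem gamePoint_pos {Ω I : Type*} [Fintype I] {lam : ℝ} (hlam : lam ∈ Set.Ioo (0 : ℝ) 1)
    {x : Ω → stdSimplex ℝ I} (hx : ∀ ω i, 0 < x ω i) : ∀ s, 0 < gamePoint lam x s
  | none => div_pos hlam.1 (sub_pos.2 hlam.2)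
  | some p => hx p.1 p.2

theorem tendsto_log_gamePoint_none {Ω I : Type*} [Fintype I] (X : ℝ → Ω → stdSimplex ℝ I) :
    Tendsto (fun t => Real.log (gamePoint t (X t) none) - Real.log t) (𝓝[>] 0) (𝓝 0) := by
  have h : Tendsto (fun t : ℝ => -Real.log (1 - t)) (𝓝[>] 0) (𝓝 0) := by
    have h1 : Tendsto (fun t : ℝ => 1 - t) (𝓝[>] 0) (𝓝 1) := by
      have : Tendsto (fun t : ℝ => 1 - t) (𝓝 0) (𝓝 (1 - 0)) :=
        (continuous_const.sub continuous_id).tendsto 0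
      rw [sub_zero] at this
      exact this.mono_left nhdsWithin_le_nhds
    simpa using (h1.log one_ne_zero).neg
  refine h.congr' ?_
  filter_upwards [Ioo_mem_nhdsGT (zero_lt_one' ℝ)] with t ht
  rw [gamePoint, Real.log_div ht.1.ne' (sub_pos.2 ht.2).ne']
  ring

namespace StochasticGame

variable {Ω I J : Type*} [Fintype Ω] [Fintype I] [Fintype J]

/-- Against a pure stationary strategy, the payoff of a fully supported stationary strategy is a
subtraction-free function of the discount ratio and of the probabilities of the actions. -/
theorem exists_subtractionFree_payoff (G : StochasticGame Ω I J) (b : Ω → J) (ω : Ω) :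
    ∃ f, SubtractionFree f ∧ ∀ lam ∈ Set.Ioo (0 : ℝ) 1, ∀ x : Ω → stdSimplex ℝ I,
      (∀ ω i, 0 < x ω i) →
      G.payoff lam ω (stationaryOne x) (stationaryTwo fun ω' => pureAction (b ω')) =
        f (gamePoint lam x) := by
  classical
  obtain ⟨f, hf, hfw⟩ := exists_subtractionFree_solution (σ := Option (Ω × I)) Finset.univ
    (fun _ z => z none) (fun ω z => z none * ∑ i, z (some (ω, i)) * G.g ω i (b ω))
    (fun ω ω' z => ∑ i, z (some (ω, i)) * G.q ω i (b ω) ω')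
    (fun _ => .coord none) (fun _ z hz => hz none)
    (fun ω => (SubtractionFree.coord none).mul (.sum _ fun i _ =>
      (SubtractionFree.coord _).mul (.const (G.g_nonneg _ _ _))))
    (fun ω ω' => .sum _ fun i _ => (SubtractionFree.coord _).mul (.const ((G.q _ _ _).2.1 _)))
    ω (Finset.mem_univ ω)
  refine ⟨f, hf, fun lam hlam x hx => hfw _ (gamePoint_pos hlam hx) (fun ω => G.payoff lam ω
    (stationaryOne x) (stationaryTwo fun ω' => pureAction (b ω'))) fun ω _ => ?_⟩
  set u : Ω → ℝ := fun ω => G.payoff lam ω (stationaryOne x)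
    (stationaryTwo fun ω' => pureAction (b ω'))
  have hlam' : lam ∈ Set.Ioc (0 : ℝ) 1 := ⟨hlam.1, hlam.2.le⟩
  let r : ℝ := ∑ i, x ω i * G.g ω i (b ω)
  let p : Ω → ℝ := fun ω' => ∑ i, x ω i * G.q ω i (b ω) ω'
  have hbellman : u ω = lam * r + (1 - lam) * ∑ ω', p ω' * u ω' := by
    have h1 : u ω = mixedPayoff (G.oneShot lam u ω) (x ω) (pureAction (b ω)) :=
      G.payoff_stationary_eq hlam' x _ ω
    rw [mixedPayoff_pureAction] at h1
    rw [h1]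
    simp only [oneShot, mul_add, Finset.sum_add_distrib, r, p, Finset.mul_sum, Finset.sum_mul]
    congr 1
    · exact Finset.sum_congr rfl fun i _ => by ring
    · rw [Finset.sum_comm]
      exact Finset.sum_congr rfl fun ω' _ => Finset.sum_congr rfl fun i _ => by ring
  have hp : ∑ ω', p ω' = 1 := by
    have h1 : ∑ i, x ω i = 1 := (x ω).2.2
    have h2 : ∀ i, ∑ ω', G.q ω i (b ω) ω' = 1 := fun i => (G.q ω i (b ω)).2.2
    simp only [p]
    rw [Finset.sum_comm]
    simp only [← Finset.mul_sum, h2, mul_one, h1]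
  have h1 := Finset.add_sum_erase Finset.univ p (Finset.mem_univ ω)
  have h2 := Finset.add_sum_erase Finset.univ (fun ω' => p ω' * u ω') (Finset.mem_univ ω)
  change (lam / (1 - lam) + ∑ ω' ∈ Finset.univ.erase ω, p ω') * u ω =
    lam / (1 - lam) * r + ∑ ω' ∈ Finset.univ.erase ω, p ω' * u ω'
  have hne : 1 - lam ≠ 0 := (sub_pos.2 hlam.2).ne'
  rw [eq_sub_of_add_eq' h1, eq_sub_of_add_eq' h2, hp]
  field_simp
  linear_combination hbellman

/-- Along an ultrafilter of vanishing discount factors, a family of fully supported stationary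
strategies can be replaced by a canonical family without changing the limit payoffs against the
pure stationary strategies of player 2. -/
theorem exists_canonicalData_of_ultrafilter [Nonempty I] (G : StochasticGame Ω I J)
    (U : Ultrafilter ℝ) (hU : (U : Filter ℝ) ≤ 𝓝[>] 0) (X : ℝ → Ω → stdSimplex ℝ I)
    (hX : ∀ᶠ lam in U, ∀ ω i, 0 < X lam ω i) :
    ∃ x : CanonicalData Ω I, ∀ (b : Ω → J) (ω : Ω), ∃ r,
      Tendsto (fun lam => G.payoff lam ω (stationaryOne (X lam))
        (stationaryTwo fun ω' => pureAction (b ω'))) U (𝓝 r) ∧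
      Tendsto (fun lam => G.payoff lam ω (stationaryOne (x.family lam))
        (stationaryTwo fun ω' => pureAction (b ω'))) (𝓝[>] 0) (𝓝 r) := by
  classical
  choose f hf hfpay using G.exists_subtractionFree_payoff
  choose T hT using fun b ω => (hf b ω).exists_transfer (α := ℝ) (β := ℝ)
  let ℓ : ℝ → Option (Ω × I) → ℝ := fun lam s => Real.log (gamePoint lam (X lam) s)
  have hsmall : ∀ᶠ lam in 𝓝[>] (0 : ℝ), lam ∈ Set.Ioo (0 : ℝ) 1 := Ioo_mem_nhdsGT one_pos
  have hnone : Tendsto (fun lam => ℓ lam none) U atBot := by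
    refine Tendsto.mono_left ?_ hU
    simpa using (tendsto_log_gamePoint_none X).add_atBot Real.tendsto_log_nhdsGT_zero
  -- The vectors `Pi.single s 1` are included to control the signs of the exponents and the limits
  -- of the probabilities themselves.
  let T' : Finset (Option (Ω × I) → ℝ) :=
    (Finset.univ.biUnion fun b => Finset.univ.biUnion fun ω => T b ω) ∪
      Finset.univ.image fun s => Pi.single s 1
  obtain ⟨e, d, he, hd, hed⟩ := exists_exponents U ℓ T' none hnone
  have hlimX : ∀ ω i, ∃ ρ, Tendsto (fun lam => X lam ω i) U (𝓝 ρ) := fun ω i => by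
    obtain ⟨ρ, -, hρ⟩ := isCompact_Icc.ultrafilter_le_nhds (U.map fun lam => X lam ω i)
      (le_principal_iff.2 (Eventually.of_forall (f := (U : Filter ℝ)) fun lam =>
        ⟨(X lam ω).2.1 i, (mem_Icc_of_mem_stdSimplex (X lam ω).2 i).2⟩))
    exact ⟨ρ, hρ⟩
  choose ρ hρ using hlimX
  have hcoord : ∀ ω i, 0 ≤ e (some (ω, i)) ∧
      (if e (some (ω, i)) = 0 then Real.exp (d (some (ω, i))) else 0) = ρ ω i := by
    intro ω i
    have hmem := hed (Pi.single (some (ω, i)) 1) (Finset.mem_union_right _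
      (Finset.mem_image_of_mem _ (Finset.mem_univ _)))
    simp only [pairing_single_one, ℓ, gamePoint] at hmem
    rcases (ge_of_tendsto' (hρ ω i) fun lam => (X lam ω).2.1 i).eq_or_lt with h0 | hpos
    · have hpos : 0 < e (some (ω, i)) := hmem.1 <| Real.tendsto_log_nhdsGT_zero.comp <|
        tendsto_nhdsWithin_iff.2 ⟨by simpa only [← h0] using hρ ω i, hX.mono fun lam h => h ω i⟩
      exact ⟨hpos.le, by rw [if_neg hpos.ne', h0]⟩
    · obtain ⟨h1, h2⟩ := hmem.2 _ ((hρ ω i).log hpos.ne')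
      exact ⟨h1.ge, by rw [if_pos h1, h2, Real.exp_log hpos]⟩
  let x : CanonicalData Ω I :=
    { c := fun ω i => Real.exp (d (some (ω, i)))
      e := fun ω i => e (some (ω, i))
      c_pos := fun ω i => Real.exp_pos _
      e_nonneg := fun ω i => (hcoord ω i).1
      sum_c := fun ω => by
        rw [Finset.sum_filter, Finset.sum_congr rfl fun i _ => (hcoord ω i).2]
        refine tendsto_nhds_unique (tendsto_finsetSum Finset.univ fun i _ => hρ ω i)
          (tendsto_const_nhds.congr fun lam => ?_)
        exact (X lam ω).2.2.symm }
  have hmatch : LimitsMatch T' U ℓ (𝓝[>] 0)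
      (fun lam s => Real.log (gamePoint lam (x.family lam) s)) := by
    refine limitsMatch_of_exponents hed fun s => ?_
    rcases s with _ | ⟨ω, i⟩
    · simpa only [he, hd, zero_add, one_mul] using tendsto_log_gamePoint_none x.family
    · have h := x.tendsto_log_family ω i
      have hc : Real.log (x.c ω i) = d (some (ω, i)) := Real.log_exp _
      rw [hc] at h
      exact h
  have hxpos : ∀ᶠ lam in 𝓝[>] (0 : ℝ), ∀ ω i, 0 < x.family lam ω i := by
    filter_upwards [hsmall] with lam hlam ω i
    rw [x.family_of_pos hlam.1]
    exact x.strategy_pos hlam.1 ω i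
  refine ⟨x, fun b ω => ?_⟩
  obtain ⟨r, hr, hr'⟩ := hT b ω U (fun lam => gamePoint lam (X lam)) (𝓝[>] 0)
    (fun lam => gamePoint lam (x.family lam))
    (by filter_upwards [hU hsmall, hX] with lam hlam h using gamePoint_pos hlam h)
    (by filter_upwards [hsmall, hxpos] with lam hlam h using gamePoint_pos hlam h)
    (by
      filter_upwards [hU hsmall, hX] with lam hlam h
      rw [← hfpay b ω lam hlam _ h]
      exact (G.payoff_mem_Icc ⟨hlam.1, hlam.2.le⟩ _ _ _).2)
    (fun δ hδ => hmatch δ (Finset.mem_union_left _ (Finset.mem_biUnion.2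
      ⟨b, Finset.mem_univ b, Finset.mem_biUnion.2 ⟨ω, Finset.mem_univ ω, hδ⟩⟩)))
  refine ⟨r, hr.congr' ?_, hr'.congr' ?_⟩
  · filter_upwards [hU hsmall, hX] with lam hlam h using (hfpay b ω lam hlam _ h).symm
  · filter_upwards [hsmall, hxpos] with lam hlam h using (hfpay b ω lam hlam _ h).symm

/-- A canonical family eventually guarantees, up to `ε`, the limit of the values along an
ultrafilter. -/
theorem exists_canonicalData_guarantee [Nonempty I] [Nonempty J] (G : StochasticGame Ω I J)
    {v : ℝ → Ω → ℝ} {X : ℝ → Ω → stdSimplex ℝ I}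
    (hv : ∀ lam ∈ Set.Ioc (0 : ℝ) 1, ∀ ω, v lam ω ∈ Set.Icc (0 : ℝ) 1)
    (hX0 : ∀ lam ∈ Set.Ioc (0 : ℝ) 1, ∀ ω i, 0 < X lam ω i)
    (hX : ∀ lam ∈ Set.Ioc (0 : ℝ) 1, ∀ τ ω,
      v lam ω - lam ≤ G.payoff lam ω (stationaryOne (X lam)) τ)
    (U : Ultrafilter ℝ) (hU : (U : Filter ℝ) ≤ 𝓝[>] 0) :
    ∃ (L : Ω → ℝ) (x : CanonicalData Ω I), Tendsto v U (𝓝 L) ∧ ∀ ε > 0,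
      ∀ᶠ lam in 𝓝[>] (0 : ℝ), ∀ τ ω, L ω - ε ≤ G.payoff lam ω (stationaryOne (x.family lam)) τ := by
  have hsmall : ∀ᶠ lam in 𝓝[>] (0 : ℝ), lam ∈ Set.Ioc (0 : ℝ) 1 := Ioc_mem_nhdsGT one_pos
  have hsmallU : ∀ᶠ lam in (U : Filter ℝ), lam ∈ Set.Ioc (0 : ℝ) 1 := hU hsmall
  have hlimv : ∀ ω, ∃ L, Tendsto (fun lam => v lam ω) U (𝓝 L) := fun ω => by
    obtain ⟨L, -, hL⟩ := isCompact_Icc.ultrafilter_le_nhds (U.map fun lam => v lam ω)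
      (le_principal_iff.2 (hsmallU.mono fun lam hlam => hv lam hlam ω))
    exact ⟨L, hL⟩
  choose L hL using hlimv
  obtain ⟨x, hx⟩ := G.exists_canonicalData_of_ultrafilter U hU X (hsmallU.mono hX0)
  refine ⟨L, x, tendsto_pi_nhds.2 hL, fun ε hε => ?_⟩
  have hb : ∀ (b : Ω → J) (ω : Ω), ∀ᶠ lam in 𝓝[>] (0 : ℝ), L ω - ε ≤ G.payoff lam ω
      (stationaryOne (x.family lam)) (stationaryTwo fun ω' => pureAction (b ω')) := by
    intro b ω
    obtain ⟨r, hr, hr'⟩ := hx b ω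
    have hlam0 : Tendsto (fun lam : ℝ => lam) U (𝓝 0) :=
      tendsto_id.mono_left (hU.trans nhdsWithin_le_nhds)
    have hLr : L ω ≤ r := by
      have h1 := (hL ω).sub hlam0
      rw [sub_zero] at h1
      exact le_of_tendsto_of_tendsto h1 hr (hsmallU.mono fun lam hlam => hX lam hlam _ ω)
    exact (hr'.eventually (lt_mem_nhds (show L ω - ε < r by linarith))).mono fun _ h => h.le
  filter_upwards [hsmall, eventually_all.2 fun b => eventually_all.2 (hb b)] with lam hlam h τ ω
  obtain ⟨b, hbest⟩ := G.exists_pure_bestReply hlam (x.family lam)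
  exact (h b ω).trans (hbest τ ω)

end StochasticGame

theorem theorem1 {Ω I J : Type*} [Fintype Ω] [Fintype I] [Fintype J] [Nonempty I] [Nonempty J]
    (G : StochasticGame Ω I J) :
    ∃ v : ℝ → Ω → ℝ,
      (∀ lam ∈ Set.Ioc (0 : ℝ) 1, ∀ ω, G.IsValue lam ω (v lam ω)) ∧
      ∃ vlim : Ω → ℝ, Tendsto v (𝓝[>] (0 : ℝ)) (𝓝 vlim) ∧
        ∃ x : CanonicalData Ω I, ∀ ε > 0, ∃ lam₀ ∈ Set.Ioc (0 : ℝ) 1,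
          ∀ ω, ∀ y : Ω → stdSimplex ℝ J, ∀ lam, ∀ hlam : lam ∈ Set.Ioo 0 lam₀,
            vlim ω - ε ≤ G.payoff lam ω (stationaryOne (x.strategy lam hlam.1))
              (stationaryTwo y) := by
  have : Nonempty (Ω → stdSimplex ℝ I) :=
    ⟨fun _ => pureAction (Classical.arbitrary I)⟩
  have : Nonempty (Ω → stdSimplex ℝ J) :=
    ⟨fun _ => pureAction (Classical.arbitrary J)⟩
  choose! v X Y hval hv hX0 hX hY using fun lam (hlam : lam ∈ Set.Ioc (0 : ℝ) 1) =>
    G.exists_value_of_discounted hlam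
  have hguar := G.exists_canonicalData_guarantee hv hX0 hX
  obtain ⟨L, x, hL, hx⟩ := hguar (Ultrafilter.of (𝓝[>] 0)) (Ultrafilter.of_le _)
  have hsmall : ∀ᶠ lam in 𝓝[>] (0 : ℝ), lam ∈ Set.Ioc (0 : ℝ) 1 := Ioc_mem_nhdsGT one_pos
  -- A guarantee of player 1 bounds the values, hence their limits along all ultrafilters, below.
  have hcompare : ∀ (L L' : Ω → ℝ) (x : CanonicalData Ω I) (U : Ultrafilter ℝ),
      (U : Filter ℝ) ≤ 𝓝[>] 0 → Tendsto v U (𝓝 L') →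
      (∀ ε > 0, ∀ᶠ lam in 𝓝[>] (0 : ℝ), ∀ τ ω,
        L ω - ε ≤ G.payoff lam ω (stationaryOne (x.family lam)) τ) → L ≤ L' := by
    intro L L' x U hU hL' hx ω
    refine le_of_forall_sub_le fun ε hε => ge_of_tendsto (tendsto_pi_nhds.1 hL' ω) ?_
    filter_upwards [hU hsmall, hU (hx ε hε)] with lam hlam h
    exact (h _ ω).trans (hY lam hlam _ ω)
  refine ⟨v, hval, L, (tendsto_iff_ultrafilter _ _ _).2 fun U hU => ?_, x, fun ε hε => ?_⟩
  · obtain ⟨L', x', hL', hx'⟩ := hguar U hU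
    rwa [le_antisymm (hcompare L L' x U hU hL' hx)
      (hcompare L' L x' _ (Ultrafilter.of_le _) hL hx')]
  · obtain ⟨u, hu, hsub⟩ := (mem_nhdsGT_iff_exists_Ioo_subset).1 (hx ε hε)
    refine ⟨min u 1, ⟨lt_min hu one_pos, min_le_right _ _⟩, fun ω y lam hlam => ?_⟩
    have := hsub ⟨hlam.1, hlam.2.trans_le (min_le_left _ _)⟩ (stationaryTwo y) ω
    rwa [x.family_of_pos hlam.1] at this
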